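/- A \emph{check stack pushdown automaton} (cspda) over a finite input alphabet $A$ is a nondeterministic finite-state machine with a one-way input tape, a check stack and a pushdown stack, with finite stack alphabets, which works in two stages. In the first stage (initialisation), starting in its single initial state with both stacks empty, it may only push symbols to the check stack under finite-state control, without reading input. In the second stage the check stack is fixed, and the machine may read input and push to or pop from the pushdown stack; the read-write head sees the top symbol of the pushdown stack and the check stack symbol at the same height (or the bottom of both stacks, if the pushdown stack is empty). A word is accepted if, for some initialisation, the machine can enter an accepting state after reading all of it; $L(\mathcal M)$ denotes the set of words accepted by $\mathcal M$. Every state is either reading (it allows only moves that read an input letter) or non-reading (it allows only moves that read nothing), and there is a designated fail state, which is non-accepting, non-reading and has no outgoing moves. A configuration consists of the state and the contents of the two stacks; an entry configuration is one in which the second stage can begin after an initialisation. For an entry configuration $C$ and $w\in A^*$, $C^w$ is the configuration in which the machine, started in $C$, enters its first reading state after reading all of $w$; $C^w$ is said to fail if the machine enters the fail state before that. The cspda $\mathcal M$ is \emph{special} if: (0) in the second stage every path of non-reading moves is finite and leads to a reading state or to the fail state; (1) at the beginning of the second stage the pushdown stack is empty and the state is a reading state, and the second stage is deterministic; (2) in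 the second stage the head never moves above the top of the check stack, an attempt to do so leading to the fail state; (3) for every entry configuration $C$ and all $u,v\in A^*$ with $v\notin L(\mathcal M)$, either $C^{uv}=C^u$ or $C^{uv}$ fails. A group $G$ is a \emph{special co-ET0L group} if it has a finite inverse-closed generating set $A$ such that the co-word problem $\{w\in A^* : w\neq_G 1\}$ is the language of some special cspda with input alphabet $A$. \textbf{Theorem.} The class of special co-ET0L groups is closed under taking free products with finitely many free factors: if $G_i$ $(i\in I)$ is a finite family of special co-ET0L groups, then the free product $\ast_{i\in I}G_i$ is a special co-ET0L group. -/

import Mathlib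

/-- What a move does to the pushdown stack: nothing, push one symbol, or pop the top symbol. -/
inductive StackOp (Γ : Type) : Type
  | keep : StackOp Γ
  | push : Γ → StackOp Γ
  | pop : StackOp Γ

/-- Effect of a stack operation on a pushdown stack (listed top first). The empty stack cannot
be popped. -/
def StackOp.apply {Γ : Type} : StackOp Γ → List Γ → Option (List Γ)
  | .keep, y => some y
  | .push g, y => some (g :: y)
  | .pop, [] => none
  | .pop, _ :: y => some y

/-- A (nondeterministic) check stack pushdown automaton with input alphabet `A`, in the normal
form in which every state is either reading or non-reading and there is a single designated fail
state, which is non-accepting, non-reading and has no outgoing moves. -/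
structure CSPDA (A : Type*) where
  /-- states -/
  State : Type
  /-- check stack alphabet -/
  Chk : Type
  /-- pushdown stack alphabet -/
  Psh : Type
  finite_state : Finite State
  finite_chk : Finite Chk
  finite_psh : Finite Psh
  /-- the initial state, in which the first stage begins -/
  start : State
  /-- first stage: `initMove q (some d) q'` is a move from `q` to `q'` that pushes `d` onto the
  check stack; `initMove q none q'` is a move that leaves the check stack unchanged -/
  initMove : State → Option Chk → State → Prop
  /-- the states in which the first stage may end and the second stage begin -/
  entry : Set State
  /-- accepting states -/
  accept : Set State
  /-- reading states; the other states are the non-reading states -/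
  reading : Set State
  /-- the fail state -/
  fail : State
  /-- second stage: `move q x g d q' op` is a move from `q` to `q'` that reads `x` from the input
  (`none` for a non-reading move), is available when the read write head sees `g` on the pushdown
  stack and `d` on the check stack, and applies `op` to the pushdown stack. At the bottom of the
  stacks (empty pushdown stack) the head sees `g = none` and `d = none`; above the top of the check
  stack it sees `d = none`. -/
  move : State → Option A → Option Psh → Option Chk → State → StackOp Psh → Prop
  move_reading : ∀ {q x g d q' op}, move q x g d q' op → (x.isSome ↔ q ∈ reading)
  fail_not_accept : fail ∉ accept
  fail_not_reading : fail ∉ reading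
  fail_no_move : ∀ {x g d q' op}, ¬ move fail x g d q' op

namespace CSPDA

variable {A : Type*}

/-- A configuration: the state and the contents of the two stacks. -/
@[ext]
structure Config (M : CSPDA A) where
  state : M.State
  /-- pushdown stack, top symbol first -/
  psh : List M.Psh
  /-- check stack, bottom symbol first -/
  chk : List M.Chk

/-- The check stack symbol seen by the read write head: when the pushdown stack has height `h ≥ 1`,
this is the `h`-th check stack symbol from the bottom, if there is one. -/
def Config.seen {M : CSPDA A} (c : M.Config) : Option M.Chk :=
  match c.psh with
  | [] => none
  | _ :: y => c.chk[y.length]?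

/-- `M.Init q z`: the first stage can lead from the initial state to the state `q`, with `z` the
word written on the check stack. -/
inductive Init (M : CSPDA A) : M.State → List M.Chk → Prop
  | start : Init M M.start []
  | silent {q q' : M.State} {z : List M.Chk} : Init M q z → M.initMove q none q' → Init M q' z
  | write {q q' : M.State} {z : List M.Chk} {d : M.Chk} :
      Init M q z → M.initMove q (some d) q' → Init M q' (z ++ [d])

/-- Entry configurations: those in which the second stage begins. The pushdown stack is empty. -/
def IsEntry (M : CSPDA A) (c : M.Config) : Prop :=
  c.state ∈ M.entry ∧ c.psh = [] ∧ M.Init c.state c.chk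

/-- One move of the second stage, reading `x` (or nothing, if `x = none`). -/
def Step (M : CSPDA A) (c : M.Config) (x : Option A) (c' : M.Config) : Prop :=
  ∃ op, M.move c.state x c.psh.head? c.seen c'.state op ∧
    op.apply c.psh = some c'.psh ∧ c'.chk = c.chk

/-- `M.Run c w c'`: some finite sequence of moves of the second stage leads from `c` to `c'`, and
the word read from the input on the way is exactly `w`. -/
inductive Run (M : CSPDA A) : M.Config → List A → M.Config → Prop
  | refl (c : M.Config) : Run M c [] c
  | silent {c c' c'' : M.Config} {w : List A} : M.Step c none c' → Run M c' w c'' → Run M c w c''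
  | read {c c' c'' : M.Config} {a : A} {w : List A} :
      M.Step c (some a) c' → Run M c' w c'' → Run M c (a :: w) c''

/-- The language of `M`: the words `w` for which, after some initialisation, `M` can enter an
accepting state after reading all of `w`. -/
def language (M : CSPDA A) : Language A :=
  {w | ∃ c c', M.IsEntry c ∧ M.Run c w c' ∧ c'.state ∈ M.accept}

/-- Configurations that can occur in the second stage. -/
def Reachable (M : CSPDA A) (c : M.Config) : Prop :=
  ∃ c₀ w, M.IsEntry c₀ ∧ M.Run c₀ w c

/-- `M.After c w c'` says that `c^w = c'`: starting in the reading configuration `c`, the machine is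
in `c'` when it enters its first reading state after reading all of `w`. (Reading states have no
non-reading moves, so a run that reads exactly `w` stops at the first such state.) -/
def After (M : CSPDA A) (c : M.Config) (w : List A) (c' : M.Config) : Prop :=
  M.Run c w c' ∧ c'.state ∈ M.reading

/-- `M.Fails c w` says that `c^w` fails: starting in `c` with input `w`, the machine enters the fail
state before it reaches a reading state after reading all of `w`. -/
def Fails (M : CSPDA A) (c : M.Config) (w : List A) : Prop :=
  ∃ p c', p <+: w ∧ M.Run c p c' ∧ c'.state = M.fail

/-- Special check stack pushdown automata. -/
structure IsSpecial (M : CSPDA A) : Prop where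
  /-- (0) In the second stage, there is no infinite path of non-reading moves ... -/
  no_infinite : ¬ ∃ f : ℕ → M.Config, M.Reachable (f 0) ∧ ∀ n, M.Step (f n) none (f (n + 1))
  /-- ... and a path of non-reading moves can only end in the fail state or in a reading state. -/
  progress : ∀ c, M.Reachable c → c.state ∉ M.reading → c.state ≠ M.fail → ∃ c', M.Step c none c'
  /-- (1) The second stage begins in a reading state (with empty pushdown stack) ... -/
  entry_reading : ∀ c, M.IsEntry c → c.state ∈ M.reading
  /-- ... and is deterministic. -/
  deterministic : ∀ {q x g d q₁ op₁ q₂ op₂},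
    M.move q x g d q₁ op₁ → M.move q x g d q₂ op₂ → q₁ = q₂ ∧ op₁ = op₂
  /-- (2) The head never moves above the top of the check stack: a move that attempts this enters
  the fail state. -/
  within : ∀ c, M.Reachable c → c.psh.length ≤ c.chk.length ∨ c.state = M.fail
  /-- (3) Subwords outside the language are ignored: if `v ∉ L(M)` then `c^(uv) = c^u`, or
  `c^(uv)` fails. -/
  ignores : ∀ c, M.IsEntry c → ∀ u v : List A, v ∉ M.language →
    (∃ c', M.After c (u ++ v) c' ∧ M.After c u c') ∨ M.Fails c (u ++ v)

end CSPDA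

/-- The co-word problem of a group with respect to a finite set `A` of its elements: the words over
`A` that do not represent the identity. -/
def coWordProblem {G : Type*} [Group G] (A : Finset G) : Language A :=
  {w | (w.map (fun a : A => (a : G))).prod ≠ 1}

/-- A group is a special co-ET0L group if, for some finite inverse-closed generating set `A`, its
co-word problem with respect to `A` is accepted by a special check stack pushdown automaton with
input alphabet `A`. -/
def IsSpecialCoET0L (G : Type*) [Group G] : Prop :=
  ∃ A : Finset G, (∀ a ∈ A, a⁻¹ ∈ A) ∧ Subgroup.closure (A : Set G) = ⊤ ∧
    ∃ M : CSPDA A, M.IsSpecial ∧ M.language = coWordProblem A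

/-! The machine for the free product guesses on its check stack a sequence of segments, each holding
an entry configuration of one factor machine. Its pushdown stack represents a stack of active
syllables, each running its factor machine inside its own segment. A letter with the label of the
top syllable is passed to that syllable; a letter with another label opens a new syllable in the
first suitable segment above; a syllable that is back in its entry configuration is erased. The
machine accepts when some syllable remains.

Trivial words: by (3) for the factors, a subword over a single label with trivial value fixes the
stack of syllables or fails (`ValidFrames.wordAct_trivial`). By the normal form theorem a trivial
word reduces to the empty word by deleting such subwords (`exists_reduces`, `reduces_nil`). So it
acts as the identity or fails, which shows both that it is not accepted and that (3) holds again.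

Nontrivial words: `w` reduces to a nonempty alternating word. If the successive segments at the
bottom hold entry configurations moved by its successive syllables, the reduced word leaves one
active syllable for each of them (`length_wordAct_flatMap`). The word `w` has the same effect unless
it fails. Failure is avoided by entry configurations that survive all words of length at most `|w|`,
and by `|w|` further blocks of segments of all labels (`Safe.wordAct_ne_none`). Such entry
configurations exist by `exists_entry_wordAct_ne`: an accepting run on a trivial word made of pieces
`u u⁻¹`, followed by the given nontrivial word, survives all the `u`.

That the automaton carries out this action, never leaving the check stack, is `run_frameAct`. Hence
it halts on every input, which together with determinism gives (0) and (2)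
(`Deterministic.isSpecial`). -/

/-- The partial right action of words induced by a partial right action of letters. -/
def wordAct {X B : Type*} (act : X → B → Option X) : X → List B → Option X
  | x, [] => some x
  | x, b :: w => (act x b).bind fun y => wordAct act y w

section wordAct

variable {X B : Type*} (act : X → B → Option X)

@[simp] theorem wordAct_nil (x : X) : wordAct act x [] = some x := rfl

theorem wordAct_cons (x : X) (b : B) (w : List B) :
    wordAct act x (b :: w) = (act x b).bind fun y => wordAct act y w := rfl

theorem wordAct_append (x : X) (u v : List B) :
    wordAct act x (u ++ v) = (wordAct act x u).bind fun y => wordAct act y v := by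
  induction u generalizing x with
  | nil => rfl
  | cons b u ih =>
    simp only [List.cons_append, wordAct_cons, Option.bind_assoc]
    congr 1; funext y; exact ih y

theorem wordAct_singleton (x : X) (b : B) : wordAct act x [b] = act x b := by
  simp [wordAct_cons]

theorem wordAct_append_of_eq_some {x y : X} {u : List B} (h : wordAct act x u = some y)
    (v : List B) : wordAct act x (u ++ v) = wordAct act y v := by
  simp [wordAct_append, h]

theorem wordAct_ne_none_of_append {x : X} {u v : List B}
    (h : wordAct act x (u ++ v) ≠ none) : wordAct act x u ≠ none := by
  intro h'
  simp [wordAct_append, h'] at h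

end wordAct

/-! ### Runs, determinism, and the partial action of words on configurations. -/

namespace CSPDA

variable {A : Type*} {M : CSPDA A}

/-- Runs of the second stage all of whose configurations lie in `W`. -/
inductive RunIn (M : CSPDA A) (W : M.Config → Prop) : M.Config → List A → M.Config → Prop
  | refl {c : M.Config} : W c → RunIn M W c [] c
  | silent {c c' c'' : M.Config} {w : List A} :
      W c → M.Step c none c' → RunIn M W c' w c'' → RunIn M W c w c''
  | read {c c' c'' : M.Config} {a : A} {w : List A} :
      W c → M.Step c (some a) c' → RunIn M W c' w c'' → RunIn M W c (a :: w) c''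

theorem RunIn.left {W : M.Config → Prop} {c c' : M.Config} {w : List A}
    (h : M.RunIn W c w c') : W c := by
  cases h <;> assumption

theorem RunIn.run {W : M.Config → Prop} {c c' : M.Config} {w : List A}
    (h : M.RunIn W c w c') : M.Run c w c' := by
  induction h with
  | refl => exact .refl _
  | silent _ hs _ ih => exact .silent hs ih
  | read _ hs _ ih => exact .read hs ih

theorem RunIn.trans {W : M.Config → Prop} {c c' c'' : M.Config} {u v : List A}
    (h : M.RunIn W c u c') (h' : M.RunIn W c' v c'') : M.RunIn W c (u ++ v) c'' := by
  induction h with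
  | refl => exact h'
  | silent hW hs _ ih => exact .silent hW hs (ih h')
  | read hW hs _ ih => exact .read hW hs (ih h')

theorem Run.runIn {c c' : M.Config} {w : List A} (h : M.Run c w c') :
    M.RunIn (fun _ => True) c w c' := by
  induction h with
  | refl => exact .refl trivial
  | silent hs _ ih => exact .silent trivial hs ih
  | read hs _ ih => exact .read trivial hs ih

theorem Run.trans {c c' c'' : M.Config} {u v : List A}
    (h : M.Run c u c') (h' : M.Run c' v c'') : M.Run c (u ++ v) c'' :=
  (h.runIn.trans h'.runIn).run

theorem Run.chk_eq {c c' : M.Config} {w : List A} (h : M.Run c w c') : c'.chk = c.chk := by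
  induction h with
  | refl => rfl
  | silent hs _ ih => obtain ⟨_, _, _, h⟩ := hs; rw [ih, h]
  | read hs _ ih => obtain ⟨_, _, _, h⟩ := hs; rw [ih, h]

theorem Step.mem_reading {c c' : M.Config} {a : A} (h : M.Step c (some a) c') :
    c.state ∈ M.reading := by
  obtain ⟨_, h, _⟩ := h
  exact (M.move_reading h).1 rfl

theorem Step.notMem_reading {c c' : M.Config} (h : M.Step c none c') :
    c.state ∉ M.reading := by
  obtain ⟨_, h, _⟩ := h
  exact fun h' => by simpa using (M.move_reading h).2 h'

theorem Step.state_ne_fail {c c' : M.Config} {x : Option A} (h : M.Step c x c') :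
    c.state ≠ M.fail := by
  obtain ⟨_, h, _⟩ := h
  intro h'
  rw [h'] at h
  exact M.fail_no_move h

theorem not_step_none {c : M.Config} (h : c.state ∈ M.reading ∨ c.state = M.fail)
    (c' : M.Config) : ¬ M.Step c none c' := fun hs =>
  h.elim hs.notMem_reading hs.state_ne_fail

theorem ne_fail_of_reading {q : M.State} (h : q ∈ M.reading) : q ≠ M.fail :=
  fun h' => M.fail_not_reading (h' ▸ h)

theorem Run.eq_of_nil {c c' : M.Config} (h : M.Run c [] c')
    (hc : c.state ∈ M.reading ∨ c.state = M.fail) : c' = c := by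
  cases h with
  | refl => rfl
  | silent hs _ => exact absurd hs (not_step_none hc _)

/-- Each available move is unique. -/
structure Deterministic (M : CSPDA A) : Prop where
  unique : ∀ {q x g d q₁ op₁ q₂ op₂},
    M.move q x g d q₁ op₁ → M.move q x g d q₂ op₂ → q₁ = q₂ ∧ op₁ = op₂

theorem Deterministic.step (hM : M.Deterministic) {c c₁ c₂ : M.Config} {x : Option A}
    (h₁ : M.Step c x c₁) (h₂ : M.Step c x c₂) : c₁ = c₂ := by
  obtain ⟨op₁, m₁, a₁, k₁⟩ := h₁
  obtain ⟨op₂, m₂, a₂, k₂⟩ := h₂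
  obtain ⟨hq, rfl⟩ := hM.unique m₁ m₂
  rw [a₁] at a₂
  exact Config.ext hq (Option.some.inj a₂) (k₁.trans k₂.symm)

/-- In a deterministic machine, a run extends to any halting run on a longer word. -/
theorem Deterministic.extend (hM : M.Deterministic) {W : M.Config → Prop}
    {c c₁ c₂ : M.Config} {u t : List A} (h₁ : M.Run c u c₁) (h₂ : M.RunIn W c (u ++ t) c₂)
    (hc : c₂.state ∈ M.reading ∨ c₂.state = M.fail) : M.RunIn W c₁ t c₂ := by
  generalize hw : u ++ t = w at h₂
  induction h₁ generalizing w with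
  | refl => subst hw; exact h₂
  | silent hs _ ih =>
    cases h₂ with
    | refl => exact absurd hs (not_step_none hc _)
    | silent _ hs' h' => exact ih _ hw (hM.step hs hs' ▸ h')
    | read _ hs' _ => exact absurd hs'.mem_reading hs.notMem_reading
  | read hs _ ih =>
    cases h₂ with
    | refl => simp at hw
    | silent _ hs' _ => exact absurd hs.mem_reading hs'.notMem_reading
    | read _ hs' h' =>
      obtain ⟨rfl, hw'⟩ := List.cons.inj hw
      exact ih _ hw' (hM.step hs hs' ▸ h')

/-- In a deterministic machine, nothing is read after entering the fail state. -/
theorem Deterministic.prefix_of_fail (hM : M.Deterministic) {W : M.Config → Prop}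
    {c c₁ c₂ : M.Config} {p w : List A} (h₂ : M.RunIn W c p c₂) (hc : c₂.state = M.fail)
    (hp : p <+: w) (h₁ : M.Run c w c₁) : w = p := by
  induction h₂ generalizing w with
  | refl =>
    cases h₁ with
    | refl => rfl
    | silent hs _ => exact absurd hc hs.state_ne_fail
    | read hs _ => exact absurd hc hs.state_ne_fail
  | silent _ hs _ ih =>
    cases h₁ with
    | refl =>
      exact (List.prefix_nil.1 hp).symm
    | silent hs' h' => exact ih hc hp (hM.step hs hs' ▸ h')
    | read hs' _ => exact absurd hs'.mem_reading hs.notMem_reading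
  | read _ hs _ ih =>
    cases h₁ with
    | refl => simp at hp
    | silent hs' _ => exact absurd hs.mem_reading hs'.notMem_reading
    | read hs' h' =>
      obtain ⟨rfl, hp'⟩ := List.cons_prefix_cons.1 hp
      rw [ih hc hp' (hM.step hs hs' ▸ h')]

/-- The fail state has no moves, so a failing prefix must be all of `w`; then both runs halt on the
same input and coincide, but the fail state is not reading. -/
theorem Deterministic.not_fails (hM : M.Deterministic) {c c' : M.Config} {w : List A}
    (h : M.After c w c') : ¬ M.Fails c w := by
  rintro ⟨p, d, hp, hd, hf⟩
  have := hM.prefix_of_fail hd.runIn hf hp h.1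
  subst this
  have h' := hM.extend h.1 (t := []) (by simpa using hd.runIn) (.inr hf)
  have := h'.run.eq_of_nil (.inl h.2)
  exact ne_fail_of_reading h.2 (this ▸ hf)

theorem Deterministic.after_unique (hM : M.Deterministic) {c c₁ c₂ : M.Config} {w : List A}
    (h₁ : M.After c w c₁) (h₂ : M.After c w c₂) : c₁ = c₂ :=
  ((hM.extend h₁.1 (t := []) (by simpa using h₂.1.runIn) (.inl h₂.2)).run.eq_of_nil
    (.inl h₁.2)).symm

/-- A run that goes on to read a further letter passes through a reading state before. -/
theorem Run.split {c c' : M.Config} {u t : List A} (h : M.Run c (u ++ t) c')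
    (ht : t ≠ [] ∨ c'.state ∈ M.reading) : ∃ m, M.After c u m ∧ M.Run m t c' := by
  generalize hw : u ++ t = w at h
  induction h generalizing u with
  | refl c =>
    obtain ⟨rfl, rfl⟩ := List.append_eq_nil_iff.1 hw
    exact ⟨c, ⟨.refl c, by simpa using ht⟩, .refl c⟩
  | silent hs _ ih =>
    obtain ⟨m, hm, hm'⟩ := ih ht hw
    exact ⟨m, ⟨.silent hs hm.1, hm.2⟩, hm'⟩
  | @read c _ _ a w hs h ih =>
    cases u with
    | nil =>
      simp only [List.nil_append] at hw
      subst hw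
      exact ⟨c, ⟨.refl c, hs.mem_reading⟩, .read hs h⟩
    | cons b u =>
      simp only [List.cons_append, List.cons.injEq] at hw
      obtain ⟨rfl, hw⟩ := hw
      obtain ⟨m, hm, hm'⟩ := ih ht hw
      exact ⟨m, ⟨.read hs hm.1, hm.2⟩, hm'⟩

open Classical in
/-- The partial action of input letters on reading configurations. -/
noncomputable def letterAct (M : CSPDA A) (c : M.Config) (a : A) : Option M.Config :=
  if h : ∃ c', M.After c [a] c' then some h.choose else none

theorem after_of_letterAct {c c' : M.Config} {a : A} (h : M.letterAct c a = some c') :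
    M.After c [a] c' := by
  unfold letterAct at h
  split_ifs at h with h'
  exact Option.some.inj h ▸ h'.choose_spec

theorem Deterministic.letterAct_of_after (hM : M.Deterministic) {c c' : M.Config} {a : A}
    (h : M.After c [a] c') : M.letterAct c a = some c' := by
  have h' : ∃ c', M.After c [a] c' := ⟨c', h⟩
  rw [letterAct, dif_pos h', hM.after_unique h'.choose_spec h]

/-- A run splits at the reading states reached between letters. This turns condition (3) into a
statement about a partial action. -/
theorem Deterministic.wordAct_eq_some_iff (hM : M.Deterministic) {c c' : M.Config} {w : List A}
    (hc : c.state ∈ M.reading) : wordAct M.letterAct c w = some c' ↔ M.After c w c' := by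
  induction w generalizing c with
  | nil =>
    rw [wordAct_nil, Option.some_inj]
    constructor
    · rintro rfl
      exact ⟨.refl _, hc⟩
    · exact fun h => (h.1.eq_of_nil (.inl hc)).symm
  | cons a w ih =>
    rw [wordAct_cons]
    constructor
    · intro h
      obtain ⟨m, hm, h⟩ := Option.bind_eq_some_iff.1 h
      have hm := after_of_letterAct hm
      have h := (ih hm.2).1 h
      exact ⟨hm.1.trans h.1, h.2⟩
    · intro h
      obtain ⟨m, hm, h'⟩ := Run.split (u := [a]) (t := w) h.1 (.inr h.2)
      rw [hM.letterAct_of_after hm]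
      exact (ih hm.2).2 ⟨h', h.2⟩

/-- The configurations permitted in the second stage of a special machine. -/
def Within (M : CSPDA A) (c : M.Config) : Prop :=
  c.psh.length ≤ c.chk.length ∨ c.state = M.fail

section Total

variable (hM : M.Deterministic)
  (htot : ∀ c, M.IsEntry c → ∀ w, (∃ c', M.RunIn M.Within c w c' ∧ c'.state ∈ M.reading) ∨
    ∃ p c', p <+: w ∧ M.RunIn M.Within c p c' ∧ c'.state = M.fail)

include hM htot

/-- By determinism, a reachable configuration lies on the halting run of its entry configuration on
the word read so far; the rest of that run is the one wanted. -/
theorem Deterministic.halts {c : M.Config} (hc : M.Reachable c) :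
    ∃ c', M.RunIn M.Within c [] c' ∧ (c'.state ∈ M.reading ∨ c'.state = M.fail) := by
  obtain ⟨c₀, w, h₀, hw⟩ := hc
  obtain ⟨c', h', hr⟩ | ⟨p, c', hp, h', hf⟩ := htot c₀ h₀ w
  · exact ⟨c', hM.extend hw (by simpa using h') (.inl hr), .inl hr⟩
  · have := hM.prefix_of_fail h' hf hp hw
    subst this
    exact ⟨c', hM.extend hw (by simpa using h') (.inr hf), .inr hf⟩

/-- A deterministic machine, all of whose runs halt without leaving the check stack, satisfies all
conditions on special machines except the last. -/
theorem Deterministic.isSpecial (hentry : ∀ c, M.IsEntry c → c.state ∈ M.reading)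
    (hign : ∀ c, M.IsEntry c → ∀ u v : List A, v ∉ M.language →
      (∃ c', M.After c (u ++ v) c' ∧ M.After c u c') ∨ M.Fails c (u ++ v)) : M.IsSpecial where
  no_infinite := by
    rintro ⟨f, h₀, hf⟩
    obtain ⟨c', h, hc'⟩ := hM.halts htot h₀
    -- An infinite silent path would have to follow the halting run to its end, where there is no
    -- silent move.
    generalize hw : ([] : List A) = w at h
    generalize hx : f 0 = x at h
    clear h₀
    induction h generalizing f with
    | refl => exact not_step_none hc' _ (hx ▸ hf 0)
    | silent _ hs _ ih =>
      exact ih (fun n => f (n + 1)) (fun n => hf (n + 1)) hc' hw (hM.step (hx ▸ hf 0) hs)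
    | read => simp at hw
  progress := by
    intro c hc hr hf
    obtain ⟨c', h, hc'⟩ := hM.halts htot hc
    cases h with
    | refl => exact absurd hc' (not_or.2 ⟨hr, hf⟩)
    | silent _ hs _ => exact ⟨_, hs⟩
  entry_reading := hentry
  deterministic := hM.unique
  within := fun c hc => (hM.halts htot hc).choose_spec.1.left
  ignores := hign

end Total

/-! ### Consequences of condition (3) for a single special machine. -/

namespace IsSpecial

variable (hM : M.IsSpecial)

include hM

theorem det : M.Deterministic := ⟨hM.deterministic⟩

theorem wordAct_append_of_notMem {c : M.Config} (hc : M.IsEntry c) (u : List A) {v : List A}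
    (hv : v ∉ M.language) : wordAct M.letterAct c (u ++ v) = none ∨
      wordAct M.letterAct c (u ++ v) = wordAct M.letterAct c u := by
  have hr := hM.entry_reading c hc
  obtain ⟨c', h, h'⟩ | h := hM.ignores c hc u v hv
  · right
    rw [(hM.det.wordAct_eq_some_iff hr).2 h, (hM.det.wordAct_eq_some_iff hr).2 h']
  · left
    rw [Option.eq_none_iff_forall_not_mem]
    intro c' hc'
    exact hM.det.not_fails ((hM.det.wordAct_eq_some_iff hr).1 hc') h

/-- Condition (3) with `v = []` says that every word either leads to a reading configuration or
fails. -/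
theorem fails_of_letterAct_eq_none (hnil : [] ∉ M.language) {e c : M.Config} (he : M.IsEntry e)
    {u : List A} (hc : wordAct M.letterAct e u = some c) {a : A}
    (ha : M.letterAct c a = none) : ∃ c', M.Run c [a] c' ∧ c'.state = M.fail := by
  have hr := hM.entry_reading e he
  have hu := (hM.det.wordAct_eq_some_iff hr).1 hc
  obtain ⟨c', h, -⟩ | ⟨p, c', hp, h, hf⟩ := hM.ignores e he (u ++ [a]) [] hnil
  · rw [List.append_nil] at h
    have := (hM.det.wordAct_eq_some_iff hr).2 h
    simp [wordAct_append, hc, wordAct_singleton, ha] at this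
  · rw [List.append_nil] at hp
    -- A failure on a prefix of `u` is impossible because `e^u` exists, so the failure occurs while
    -- `a` is processed.
    obtain hp | hp := List.prefix_concat_iff.1 (by simpa using hp)
    · subst hp
      obtain ⟨m, hm, hm'⟩ := h.split (.inl (by simp))
      exact ⟨c', hM.det.after_unique hm hu ▸ hm', hf⟩
    · exact absurd ⟨p, c', hp, h, hf⟩ (hM.det.not_fails hu)

section Group

variable {Γ : Type*} [Group Γ] {val : A → Γ} (hL : ∀ w, w ∈ M.language ↔ (w.map val).prod ≠ 1)

include hL

theorem wordAct_append_of_prod_eq_one {c : M.Config} (hc : M.IsEntry c) (u : List A) {v : List A}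
    (hv : (v.map val).prod = 1) : wordAct M.letterAct c (u ++ v) = none ∨
      wordAct M.letterAct c (u ++ v) = wordAct M.letterAct c u :=
  hM.wordAct_append_of_notMem hc u fun h => (hL v).1 h hv

/-- Each piece `u ++ inv u` is trivial, so it fixes `e` if it does not fail; the next piece then
starts from `e` again. -/
theorem wordAct_flatMap {inv : List A → List A}
    (hinv : ∀ w, ((inv w).map val).prod = (w.map val).prod⁻¹) {e : M.Config} (he : M.IsEntry e)
    {ws : List (List A)} (h : wordAct M.letterAct e (ws.flatMap fun u => u ++ inv u) ≠ none) :
    wordAct M.letterAct e (ws.flatMap fun u => u ++ inv u) = some e ∧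
      ∀ u ∈ ws, wordAct M.letterAct e u ≠ none := by
  induction ws with
  | nil => simp
  | cons u ws ih =>
    rw [List.flatMap_cons] at h ⊢
    have h₁ := wordAct_ne_none_of_append _ h
    have h₂ : wordAct M.letterAct e (u ++ inv u) = some e := by
      have := hM.wordAct_append_of_prod_eq_one hL he [] (v := u ++ inv u) (by simp [hinv])
      simpa [h₁] using this
    rw [wordAct_append_of_eq_some _ h₂] at h ⊢
    obtain ⟨h₃, h₄⟩ := ih h
    exact ⟨h₃, List.forall_mem_cons.2 ⟨wordAct_ne_none_of_append _ h₁, h₄⟩⟩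

/-- Some entry configuration is moved by a given nontrivial word, and does not fail on given
finitely many words. -/
theorem exists_entry_wordAct_ne (hinv : ∀ a, ∃ a', val a' = (val a)⁻¹) {y : List A}
    (hy : (y.map val).prod ≠ 1) (ws : List (List A)) :
    ∃ e, M.IsEntry e ∧ (∀ u ∈ ws, wordAct M.letterAct e u ≠ none) ∧
      wordAct M.letterAct e y ≠ some e := by
  have hinv' : ∀ w : List A, ∃ w' : List A, (w'.map val).prod = (w.map val).prod⁻¹ := by
    intro w
    induction w with
    | nil => exact ⟨[], by simp⟩
    | cons a w ih =>
      obtain ⟨a', ha⟩ := hinv a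
      obtain ⟨w', hw⟩ := ih
      exact ⟨w' ++ [a'], by simp [ha, hw]⟩
  choose inv hinv' using hinv'
  set W := (ws ++ [y]).flatMap fun u => u ++ inv u with hW
  have hW1 : (W.map val).prod = 1 := by
    rw [hW]
    generalize ws ++ [y] = l
    induction l with
    | nil => simp
    | cons u l ih => simpa [hinv', ← List.flatMap_def] using ih
  obtain ⟨e, c', he, hrun, hacc⟩ := (hL (W ++ y)).2 (by simpa [hW1] using hy)
  have hr := hM.entry_reading e he
  -- The accepting state need not be reading; since `y` is nonempty, the run nevertheless passes
  -- through a reading state after `W`.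
  have hy0 : y ≠ [] := by rintro rfl; simp at hy
  obtain ⟨m, hm, hm'⟩ := hrun.split (.inl hy0)
  have h₁ := (hM.det.wordAct_eq_some_iff hr).2 hm
  obtain ⟨h₂, h₃⟩ := hM.wordAct_flatMap hL hinv' he (ws := ws ++ [y]) (by simp [← hW, h₁])
  rw [← hW, h₁, Option.some_inj] at h₂
  subst h₂
  refine ⟨m, he, fun u hu => h₃ u (by simp [hu]), fun h => ?_⟩
  -- The last piece of `W` is `y ++ inv y`. If `y` fixed `m`, so would `inv y`, and the trivial word
  -- `inv y ++ y` would be accepted from `m`.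
  have h₄ : wordAct M.letterAct m (y ++ inv y) = some m := by
    have h₅ : wordAct M.letterAct m W ≠ none := by simp [h₁]
    have h₆ : W = (ws.flatMap fun u => u ++ inv u) ++ (y ++ inv y) := by simp [hW]
    have h₇ := h₁
    rw [h₆] at h₅ h₇
    have h₈ := (hM.wordAct_flatMap hL hinv' he (wordAct_ne_none_of_append _ h₅)).1
    rwa [wordAct_append_of_eq_some _ h₈] at h₇
  rw [wordAct_append_of_eq_some _ h, hM.det.wordAct_eq_some_iff hr] at h₄
  exact (hL (inv y ++ y)).1 ⟨m, c', he, h₄.1.trans hm', hacc⟩ (by simp [hinv'])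

end Group

end IsSpecial

end CSPDA

/-! ### Reducing words over a union of alphabets to alternating words -/

section Reduction

variable {B K Γ : Type*} [Group Γ] (lab : B → K) (val : B → Γ)

/-- `Reduces lab val w x`: the word `x` arises from `w` by deleting subwords with letters of a
single label and with trivial value. -/
inductive Reduces : List B → List B → Prop
  | refl (w : List B) : Reduces w w
  | delete {u v t x : List B} {k : K} : (∀ b ∈ v, lab b = k) → (v.map val).prod = 1 →
      Reduces (u ++ t) x → Reduces (u ++ (v ++ t)) x

variable {lab val}

theorem Reduces.cons {w x : List B} (h : Reduces lab val w x) (b : B) :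
    Reduces lab val (b :: w) (b :: x) := by
  induction h with
  | refl => exact .refl _
  | @delete u _ _ _ _ hk hv _ ih => exact .delete (u := b :: u) hk hv ih

theorem Reduces.trans {w x y : List B} (h : Reduces lab val w x) (h' : Reduces lab val x y) :
    Reduces lab val w y := by
  induction h with
  | refl => exact h'
  | delete hk hv _ ih => exact .delete hk hv (ih h')

theorem Reduces.prod_eq {w x : List B} (h : Reduces lab val w x) :
    (w.map val).prod = (x.map val).prod := by
  induction h with
  | refl => rfl
  | delete _ hv _ ih => rw [← ih]; simp [hv]

variable (lab val) in
/-- Sequences of nontrivial words, each over the letters of a single label, with adjacent labels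
distinct. -/
structure IsAlternating (xs : List (K × List B)) : Prop where
  lab_eq : ∀ p ∈ xs, ∀ b ∈ p.2, lab b = p.1
  prod_ne : ∀ p ∈ xs, (p.2.map val).prod ≠ 1
  chain : xs.IsChain fun p q => p.1 ≠ q.1

theorem IsAlternating.tail {p : K × List B} {xs : List (K × List B)}
    (h : IsAlternating lab val (p :: xs)) : IsAlternating lab val xs where
  lab_eq q hq := h.lab_eq q (.tail _ hq)
  prod_ne q hq := h.prod_ne q (.tail _ hq)
  chain := h.chain.tail

/-- Letters are added on the left: a letter joins the first syllable if the labels agree, and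
otherwise starts a new one, which is nontrivial by `hval`. A first syllable that becomes trivial is
deleted, and the tail is still alternating. -/
theorem exists_reduces (hval : ∀ b, val b ≠ 1) (w : List B) :
    ∃ xs : List (K × List B), IsAlternating lab val xs ∧
      Reduces lab val w (xs.flatMap Prod.snd) := by
  classical
  induction w with
  | nil => exact ⟨[], ⟨by simp, by simp, by simp⟩, .refl _⟩
  | cons b w ih =>
    obtain ⟨xs, hxs, hw⟩ := ih
    have hw := hw.cons b
    obtain _ | ⟨⟨k, x⟩, xs⟩ := xs
    · exact ⟨[(lab b, [b])], ⟨by simp, by simpa using hval b, by simp⟩, by simpa using hw⟩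
    by_cases hk : k = lab b
    · subst hk
      have hx : ∀ c ∈ b :: x, lab c = lab b :=
        List.forall_mem_cons.2 ⟨rfl, hxs.lab_eq (lab b, x) (by simp)⟩
      by_cases h1 : ((b :: x).map val).prod = 1
      · refine ⟨xs, hxs.tail, hw.trans ?_⟩
        have := Reduces.delete (u := []) (t := xs.flatMap Prod.snd) hx h1 (.refl _)
        simpa using this
      · refine ⟨(lab b, b :: x) :: xs, ⟨?_, ?_, ?_⟩, by simpa using hw⟩
        · exact List.forall_mem_cons.2 ⟨hx, hxs.tail.lab_eq⟩
        · exact List.forall_mem_cons.2 ⟨h1, hxs.tail.prod_ne⟩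
        · have := hxs.chain
          rw [List.isChain_cons] at this ⊢
          exact this
    · refine ⟨(lab b, [b]) :: (k, x) :: xs, ⟨?_, ?_, ?_⟩, by simpa using hw⟩
      · exact List.forall_mem_cons.2 ⟨by simp, hxs.lab_eq⟩
      · exact List.forall_mem_cons.2 ⟨by simpa using hval b, hxs.prod_ne⟩
      · exact List.isChain_cons_cons.2 ⟨Ne.symm hk, hxs.chain⟩

end Reduction

/-! ### The action on stacks of syllables -/

/-- A syllable that is being processed: the segment it uses, which provides its initial
configuration, the current configuration, and the segments above. -/
structure Frame (Y : Type*) where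
  seg : Y
  cur : Y
  above : List Y

section Frames

variable {Y B K Γ : Type*} [DecidableEq K] (lbl : Y → K) (lab : B → K) (act : Y → B → Option Y)

/-- The first segment with label `k`, and the segments above it. -/
def findSeg (k : K) : List Y → Option (Y × List Y)
  | [] => none
  | y :: ys => if lbl y = k then some (y, ys) else findSeg k ys

/-- The segments that are available for a new syllable. -/
def room (S : List Y) : List (Frame Y) → List Y
  | [] => S
  | f :: _ => f.above

open Classical in
/-- Update the configuration of the top syllable, dropping it on return to its initial
configuration. -/
noncomputable def settle (y : Y) (ys : List Y) (fs : List (Frame Y)) (e : Y) : List (Frame Y) :=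
  if e = y then fs else ⟨y, e, ys⟩ :: fs

/-- Process a letter as the beginning of a new syllable. -/
noncomputable def openFrame (S : List Y) (fs : List (Frame Y)) (b : B) : Option (List (Frame Y)) :=
  (findSeg lbl (lab b) (room S fs)).bind fun p => (act p.1 b).map (settle p.1 p.2 fs)

/-- Process a letter. -/
noncomputable def frameAct (S : List Y) : List (Frame Y) → B → Option (List (Frame Y))
  | [], b => openFrame lbl lab act S [] b
  | f :: fs, b =>
    if lbl f.seg = lab b then (act f.cur b).map (settle f.seg f.above fs)
    else openFrame lbl lab act S (f :: fs) b

/-- `y` is the segment for a new syllable on top of `fs`. -/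
structure Opens (S : List Y) (fs : List (Frame Y)) (y : Y) (ys : List Y) : Prop where
  find : findSeg lbl (lbl y) (room S fs) = some (y, ys)
  top_ne : ∀ f ∈ fs.head?, lbl f.seg ≠ lbl y

/-- `e` arises from `y` by the action of letters with the label of `y`. -/
def InOrbit (y e : Y) : Prop :=
  ∃ u : List B, (∀ b ∈ u, lab b = lbl y) ∧ wordAct act y u = some e

/-- The stacks of syllables that can arise. -/
inductive ValidFrames (S : List Y) : List (Frame Y) → Prop
  | nil : ValidFrames S []
  | cons {f : Frame Y} {fs : List (Frame Y)} : ValidFrames S fs → Opens lbl S fs f.seg f.above →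
      InOrbit lbl lab act f.seg f.cur → f.cur ≠ f.seg → ValidFrames S (f :: fs)

variable {lbl lab act} {S : List Y}

theorem findSeg_eq_some {k : K} {y : Y} {l ys : List Y} (h : findSeg lbl k l = some (y, ys)) :
    lbl y = k ∧ ∃ l', l = l' ++ y :: ys ∧ ∀ z ∈ l', lbl z ≠ k := by
  induction l with
  | nil => simp [findSeg] at h
  | cons z l ih =>
    rw [findSeg] at h
    split_ifs at h with hz
    · cases h
      exact ⟨hz, [], by simp⟩
    · obtain ⟨h₁, l', rfl, h₂⟩ := ih h
      exact ⟨h₁, z :: l', rfl, List.forall_mem_cons.2 ⟨hz, h₂⟩⟩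

theorem findSeg_eq_none {k : K} {l : List Y} (h : findSeg lbl k l = none) :
    ∀ z ∈ l, lbl z ≠ k := by
  induction l with
  | nil => simp
  | cons z l ih =>
    rw [findSeg] at h
    split_ifs at h with hz
    exact List.forall_mem_cons.2 ⟨hz, ih h⟩

theorem ValidFrames.room_suffix {fs : List (Frame Y)} (h : ValidFrames lbl lab act S fs) :
    room S fs <:+ S := by
  induction h with
  | nil => exact List.suffix_refl _
  | cons _ ho _ _ ih =>
    obtain ⟨-, l', hl, -⟩ := findSeg_eq_some ho.find
    exact .trans ⟨l' ++ [_], by simpa [room] using hl.symm⟩ ih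

theorem ValidFrames.mem {fs : List (Frame Y)} (h : ValidFrames lbl lab act S fs) {y : Y}
    {ys : List Y} (ho : Opens lbl S fs y ys) : y ∈ S := by
  obtain ⟨-, l', hl, -⟩ := findSeg_eq_some ho.find
  exact h.room_suffix.subset (by simp [hl])

theorem settle_self (y : Y) (ys : List Y) (fs : List (Frame Y)) : settle y ys fs y = fs :=
  if_pos rfl

theorem settle_of_ne {y e : Y} (h : e ≠ y) (ys : List Y) (fs : List (Frame Y)) :
    settle y ys fs e = ⟨y, e, ys⟩ :: fs :=
  if_neg h

theorem ValidFrames.settled {fs : List (Frame Y)} (h : ValidFrames lbl lab act S fs) {y e : Y}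
    {ys : List Y} (ho : Opens lbl S fs y ys) (he : InOrbit lbl lab act y e) :
    ValidFrames lbl lab act S (settle y ys fs e) := by
  by_cases hy : e = y
  · subst hy
    rwa [settle_self]
  · rw [settle_of_ne hy]
    exact .cons h ho he hy

/-- Erasing a syllable in its initial configuration loses nothing: a letter with its label finds the
same segment again. Thus `settle y ys fs e` treats active syllables and those not yet opened alike.
-/
theorem Opens.frameAct_settle {fs : List (Frame Y)} {y : Y} {ys : List Y}
    (ho : Opens lbl S fs y ys) (e : Y) {b : B} (hb : lab b = lbl y) :
    frameAct lbl lab act S (settle y ys fs e) b = (act e b).map (settle y ys fs) := by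
  by_cases hy : e = y
  · subst hy
    rw [settle_self]
    obtain _ | ⟨f, fs⟩ := fs
    · simp [frameAct, openFrame, hb, ho.find]
    · have := ho.top_ne f rfl
      rw [frameAct, if_neg (hb ▸ this)]
      simp [openFrame, hb, ho.find]
  · rw [settle_of_ne hy, frameAct, if_pos hb.symm]

theorem Opens.wordAct_settle {fs : List (Frame Y)} {y : Y} {ys : List Y}
    (ho : Opens lbl S fs y ys) (e : Y) {v : List B} (hv : ∀ b ∈ v, lab b = lbl y) :
    wordAct (frameAct lbl lab act S) (settle y ys fs e) v =
      (wordAct act e v).map (settle y ys fs) := by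
  induction v generalizing e with
  | nil => rfl
  | cons b v ih =>
    obtain ⟨hb, hv⟩ := List.forall_mem_cons.1 hv
    rw [wordAct_cons, wordAct_cons, ho.frameAct_settle e hb]
    cases act e b with
    | none => rfl
    | some e' => simpa using ih e' hv

theorem openFrame_eq_none {fs : List (Frame Y)} {b : B}
    (h : findSeg lbl (lab b) (room S fs) = none) : openFrame lbl lab act S fs b = none := by
  simp [openFrame, h]

theorem frameAct_eq_openFrame {fs : List (Frame Y)} {b : B}
    (h : ∀ f ∈ fs.head?, lbl f.seg ≠ lab b) :
    frameAct lbl lab act S fs b = openFrame lbl lab act S fs b := by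
  cases fs with
  | nil => rfl
  | cons f fs => rw [frameAct, if_neg (h f rfl)]

/-- For any label the stack may be regarded as having a syllable of that label on top, possibly
still in its initial configuration, unless no segment is left for it. -/
theorem ValidFrames.exists_settle {fs : List (Frame Y)} (h : ValidFrames lbl lab act S fs)
    (k : K) : (∃ y ys fs' e, ValidFrames lbl lab act S fs' ∧ Opens lbl S fs' y ys ∧ lbl y = k ∧
      InOrbit lbl lab act y e ∧ fs = settle y ys fs' e) ∨
      (findSeg lbl k (room S fs) = none ∧ ∀ f ∈ fs.head?, lbl f.seg ≠ k) := by
  by_cases htop : ∀ f ∈ fs.head?, lbl f.seg ≠ k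
  · cases hf : findSeg lbl k (room S fs) with
    | none => exact .inr ⟨rfl, htop⟩
    | some p =>
      obtain ⟨y, ys⟩ := p
      have hy := (findSeg_eq_some hf).1
      subst hy
      exact .inl ⟨y, ys, fs, y, h, ⟨hf, htop⟩, rfl, ⟨[], by simp, rfl⟩, (settle_self _ _ _).symm⟩
  · left
    cases h with
    | nil => simp at htop
    | @cons f fs h ho hc hne =>
      have hk : lbl f.seg = k := by simpa using htop
      exact ⟨f.seg, f.above, fs, f.cur, h, ho, hk, hc, (settle_of_ne hne _ _).symm⟩

omit [DecidableEq K] in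
theorem InOrbit.next {y e e' : Y} (h : InOrbit lbl lab act y e) {b : B} (hb : lab b = lbl y)
    (he : act e b = some e') : InOrbit lbl lab act y e' := by
  obtain ⟨u, hu, h⟩ := h
  refine ⟨u ++ [b], ?_, by rw [wordAct_append_of_eq_some _ h, wordAct_singleton, he]⟩
  simpa [or_imp, forall_and, hb] using hu

theorem ValidFrames.next {fs fs' : List (Frame Y)} (h : ValidFrames lbl lab act S fs) {b : B}
    (hb : frameAct lbl lab act S fs b = some fs') : ValidFrames lbl lab act S fs' := by
  obtain ⟨y, ys, fs₀, e, h₀, ho, hy, he, rfl⟩ | h' := h.exists_settle (lab b)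
  · rw [ho.frameAct_settle e hy.symm] at hb
    obtain ⟨e', he', rfl⟩ := Option.map_eq_some_iff.1 hb
    exact h₀.settled ho (he.next hy.symm he')
  · rw [frameAct_eq_openFrame h'.2, openFrame_eq_none h'.1] at hb
    simp at hb

theorem ValidFrames.nextWord {fs fs' : List (Frame Y)} (h : ValidFrames lbl lab act S fs)
    {w : List B} (hw : wordAct (frameAct lbl lab act S) fs w = some fs') :
    ValidFrames lbl lab act S fs' := by
  induction w generalizing fs with
  | nil => cases hw; exact h
  | cons b w ih =>
    obtain ⟨fs₁, h₁, h₂⟩ := Option.bind_eq_some_iff.1 hw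
    exact ih (h.next h₁) h₂

section Trivial

variable [Group Γ] {val : B → Γ}
  (htriv : ∀ y ∈ S, ∀ u v : List B, (∀ b ∈ u, lab b = lbl y) → (∀ b ∈ v, lab b = lbl y) →
    (v.map val).prod = 1 → wordAct act y (u ++ v) = none ∨ wordAct act y (u ++ v) = wordAct act y u)

include htriv

/-- The top configuration `e` arises from the segment `y` by some `u`, so `htriv` for `u ++ v` says
that `v` fixes `e` or fails. -/
theorem ValidFrames.wordAct_trivial {fs : List (Frame Y)} (h : ValidFrames lbl lab act S fs)
    {v : List B} {k : K} (hk : ∀ b ∈ v, lab b = k) (hv : (v.map val).prod = 1) :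
    wordAct (frameAct lbl lab act S) fs v = none ∨
      wordAct (frameAct lbl lab act S) fs v = some fs := by
  obtain ⟨y, ys, fs₀, e, h₀, ho, hy, ⟨u, hu, he⟩, rfl⟩ | h' := h.exists_settle k
  · rw [ho.wordAct_settle e (hy.symm ▸ hk)]
    have := htriv y (h₀.mem ho) u v hu (hy.symm ▸ hk) hv
    rw [wordAct_append_of_eq_some _ he, he] at this
    exact this.imp (by simp +contextual) (by simp +contextual)
  · obtain _ | ⟨b, v⟩ := v
    · exact .inr rfl
    · left
      have hb := hk b (by simp)
      subst hb
      rw [wordAct_cons, frameAct_eq_openFrame h'.2, openFrame_eq_none h'.1]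
      rfl

/-- The alternative is one-sided: a deleted subword may fail where the shorter word does not. -/
theorem Reduces.wordAct_frameAct {w x : List B} (h : Reduces lab val w x) :
    wordAct (frameAct lbl lab act S) [] w = none ∨
      wordAct (frameAct lbl lab act S) [] w = wordAct (frameAct lbl lab act S) [] x := by
  induction h with
  | refl => exact .inr rfl
  | @delete u v t x k hk hv _ ih =>
    rw [wordAct_append] at ih ⊢
    cases hu : wordAct (frameAct lbl lab act S) [] u with
    | none => exact .inl rfl
    | some fs =>
      rw [hu] at ih
      simp only [Option.bind_some] at ih ⊢
      have hfs := ValidFrames.nil.nextWord hu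
      rw [wordAct_append]
      obtain h | h := hfs.wordAct_trivial htriv hk hv
      · exact .inl (by simp [h])
      · simpa [h] using ih

end Trivial

/-! ### Runs that do not fail -/

variable (lbl lab act)

/-- No word of length at most `n` over the letters with the label of `y` fails on `y`. -/
def Lasts (n : ℕ) (y : Y) : Prop :=
  ∀ u : List B, (∀ b ∈ u, lab b = lbl y) → u.length ≤ n → wordAct act y u ≠ none

/-- There is room for `n` syllables. -/
def Rich : ℕ → List Y → Prop
  | 0, _ => True
  | n + 1, S => ∀ b, ∃ y ys, findSeg lbl (lab b) S = some (y, ys) ∧ Rich n ys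

variable {lbl lab act}

theorem Rich.of_succ {n : ℕ} {l : List Y} (h : Rich lbl lab (n + 1) l) : Rich lbl lab n l := by
  induction n generalizing l with
  | zero => trivial
  | succ n ih =>
    intro b
    obtain ⟨y, ys, h₁, h₂⟩ := h b
    exact ⟨y, ys, h₁, ih h₂⟩

theorem Rich.cons {n : ℕ} {l : List Y} (h : Rich lbl lab n l) (y : Y) :
    Rich lbl lab n (y :: l) := by
  cases n with
  | zero => trivial
  | succ n =>
    intro b
    by_cases hy : lbl y = lab b
    · exact ⟨y, l, by simp [findSeg, hy], h.of_succ⟩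
    · simpa [findSeg, hy] using h b

theorem Rich.append {n : ℕ} {l : List Y} (h : Rich lbl lab n l) (l' : List Y) :
    Rich lbl lab n (l' ++ l) := by
  induction l' with
  | nil => exact h
  | cons y _ ih => exact ih.cons y

/-- The first block contains every label, so a syllable is placed in it and all later blocks remain
above. -/
theorem Rich.flatten_replicate {l : List Y} (hl : ∀ b : B, ∃ y ∈ l, lbl y = lab b) (n : ℕ) :
    Rich lbl lab n (List.replicate n l).flatten := by
  induction n with
  | zero => trivial
  | succ n ih =>
    intro b
    rw [List.replicate_succ, List.flatten_cons]
    have hb := hl b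
    clear hl
    generalize (List.replicate n l).flatten = m at *
    induction l with
    | nil => simp at hb
    | cons y l ih' =>
      by_cases hy : lbl y = lab b
      · exact ⟨y, l ++ m, by simp [findSeg, hy], ih.append l⟩
      · have hb' : ∃ y ∈ l, lbl y = lab b := by simpa [hy] using hb
        simpa [findSeg, hy] using ih' hb'

/-- Every syllable has been reached by at most `n` letters, and there is room for `m` more. -/
def Safe (S : List Y) (n m : ℕ) (fs : List (Frame Y)) : Prop :=
  Rich lbl lab m S ∧ ∀ f ∈ fs, Rich lbl lab m f.above ∧ f.seg ∈ S ∧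
    ∃ u : List B, (∀ b ∈ u, lab b = lbl f.seg) ∧ u.length ≤ n ∧ wordAct act f.seg u = some f.cur

/-- A letter lengthens the word that has acted on the top syllable by one, or opens a syllable and
uses up one level of room; the bounds `n + 1` and `m` cover both cases. -/
theorem Safe.step {N : ℕ} (hS : ∀ y ∈ S, Lasts lbl lab act N y) {n m : ℕ} (hN : n + 1 ≤ N)
    {fs : List (Frame Y)} (hv : ValidFrames lbl lab act S fs)
    (h : Safe (lbl := lbl) (lab := lab) (act := act) S n (m + 1) fs) (b : B) :
    ∃ fs', frameAct lbl lab act S fs b = some fs' ∧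
      Safe (lbl := lbl) (lab := lab) (act := act) S (n + 1) m fs' := by
  have mono : ∀ {fs}, Safe (lbl := lbl) (lab := lab) (act := act) S n (m + 1) fs →
      Safe (lbl := lbl) (lab := lab) (act := act) S (n + 1) m fs := by
    intro fs h
    refine ⟨h.1.of_succ, fun f hf => ?_⟩
    obtain ⟨h₁, h₂, u, h₃, h₄, h₅⟩ := h.2 f hf
    exact ⟨h₁.of_succ, h₂, u, h₃, by lia, h₅⟩
  have key : ∀ (y e : Y) (ys : List Y) (fs : List (Frame Y)) (u : List B), y ∈ S →
      lbl y = lab b → Rich lbl lab m ys → (∀ b ∈ u, lab b = lbl y) → u.length ≤ n →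
      wordAct act y u = some e → Safe (lbl := lbl) (lab := lab) (act := act) S n (m + 1) fs →
      ∃ fs', (act e b).map (settle y ys fs) = some fs' ∧
        Safe (lbl := lbl) (lab := lab) (act := act) S (n + 1) m fs' := by
    intro y e ys fs u hy hb hys hu hun hue hfs
    have hu' : ∀ c ∈ u ++ [b], lab c = lbl y := by
      simpa [or_imp, forall_and, hb] using hu
    have hub : wordAct act y (u ++ [b]) = act e b := by
      rw [wordAct_append_of_eq_some _ hue, wordAct_singleton]
    have hnn := hS y hy _ hu' (by simp; lia)
    rw [hub] at hnn
    obtain ⟨e', he'⟩ := Option.ne_none_iff_exists'.1 hnn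
    refine ⟨settle y ys fs e', by simp [he'], ?_⟩
    by_cases hee : e' = y
    · subst hee
      rw [settle_self]
      exact mono hfs
    · rw [settle_of_ne hee]
      refine ⟨(mono hfs).1, List.forall_mem_cons.2 ⟨?_, (mono hfs).2⟩⟩
      exact ⟨hys, hy, u ++ [b], hu', by simp; lia, hub.trans he'⟩
  have hroom : Rich lbl lab (m + 1) (room S fs) := by
    cases fs with
    | nil => exact h.1
    | cons f fs => exact (h.2 f (by simp)).1
  have hopen : ∃ fs', openFrame lbl lab act S fs b = some fs' ∧
      Safe (lbl := lbl) (lab := lab) (act := act) S (n + 1) m fs' := by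
    obtain ⟨y, ys, hf, hys⟩ := hroom b
    obtain ⟨hy, l', hl, -⟩ := findSeg_eq_some hf
    have hyS : y ∈ S := hv.room_suffix.subset (by simp [hl])
    simpa [openFrame, hf] using key y y ys fs [] hyS hy hys (by simp) (by simp) rfl h
  cases fs with
  | nil => exact hopen
  | cons f fs =>
    by_cases hf : lbl f.seg = lab b
    · obtain ⟨h₁, h₂, u, h₃, h₄, h₅⟩ := h.2 f (by simp)
      rw [frameAct, if_pos hf]
      exact key f.seg f.cur f.above fs u h₂ hf h₁.of_succ h₃ h₄ h₅
        ⟨h.1, fun g hg => h.2 g (by simp [hg])⟩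
    · rwa [frameAct, if_neg hf]

theorem Safe.wordAct_ne_none {N : ℕ} (hS : ∀ y ∈ S, Lasts lbl lab act N y) {n : ℕ}
    {fs : List (Frame Y)} (hv : ValidFrames lbl lab act S fs) {w : List B}
    (h : Safe (lbl := lbl) (lab := lab) (act := act) S n w.length fs) (hN : n + w.length ≤ N) :
    wordAct (frameAct lbl lab act S) fs w ≠ none := by
  induction w generalizing n fs with
  | nil => simp
  | cons b w ih =>
    rw [List.length_cons] at hN
    obtain ⟨fs', h₁, h₂⟩ := Safe.step hS (by lia) hv h b
    rw [wordAct_cons, h₁]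
    exact ih (hv.next h₁) h₂ (by lia)

/-- Segments that are moved by the successive syllables of an alternating word detect that it is
nontrivial. -/
theorem length_wordAct_flatMap [Group Γ] {val : B → Γ} {xs : List (K × List B)}
    (hxs : IsAlternating lab val xs) {ys zs : List Y}
    (hy : List.Forall₂ (fun p y => lbl y = p.1 ∧ wordAct act y p.2 ≠ some y) xs ys)
    {fs fs' : List (Frame Y)} (hroom : room S fs = ys ++ zs)
    (htop : ∀ f ∈ fs.head?, ∀ p ∈ xs.head?, lbl f.seg ≠ p.1)
    (h : wordAct (frameAct lbl lab act S) fs (xs.flatMap Prod.snd) = some fs') :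
    fs'.length = fs.length + xs.length := by
  induction hy generalizing fs with
  | nil => simp at h; simp [h]
  | @cons p y xs ys hp hy ih =>
    obtain ⟨hpy, hne⟩ := hp
    have ho : Opens lbl S fs y (ys ++ zs) := by
      refine ⟨by simp [hroom, findSeg], fun f hf => ?_⟩
      rw [hpy]
      exact htop f hf p rfl
    have hlab : ∀ b ∈ p.2, lab b = lbl y := by
      rw [hpy]
      exact hxs.lab_eq p (by simp)
    have hw := ho.wordAct_settle (act := act) y hlab
    rw [settle_self] at hw
    rw [List.flatMap_cons, wordAct_append, hw] at h
    cases he : wordAct act y p.2 with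
    | none => simp [he] at h
    | some e =>
      -- Since `y` is moved, its syllable stays on the stack, and `ys ++ zs` is the room for the
      -- next one.
      have hey : e ≠ y := fun h' => hne (by rw [he, h'])
      simp only [he, Option.map_some, Option.bind_some, settle_of_ne hey] at h
      rw [ih hxs.tail rfl ?_ h]
      · simp; lia
      · intro f hf q hq
        simp only [List.head?_cons, Option.mem_some_iff] at hf
        subst hf
        rw [hpy]
        have := hxs.chain
        rw [List.isChain_cons] at this
        exact this.1 q hq

end Frames

/-! ### The machine for the free product -/

/-- Rename the symbol that is pushed. -/
def StackOp.map {Γ Δ : Type} (f : Γ → Δ) : StackOp Γ → StackOp Δ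
  | .keep => .keep
  | .push g => .push (f g)
  | .pop => .pop

namespace CSPDA

section MoveFun

variable {A : Type*} (M : CSPDA A)

open Classical in
/-- The second stage moves of a deterministic machine, as a partial function. -/
noncomputable def moveFun (q : M.State) (x : Option A) (g : Option M.Psh) (d : Option M.Chk) :
    Option (M.State × StackOp M.Psh) :=
  if h : ∃ r : M.State × StackOp M.Psh, M.move q x g d r.1 r.2 then some h.choose else none

variable {M} in
theorem Deterministic.moveFun_eq (hM : M.Deterministic) {q : M.State} {x : Option A}
    {g : Option M.Psh} {d : Option M.Chk} {q' : M.State} {op : StackOp M.Psh}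
    (h : M.move q x g d q' op) : M.moveFun q x g d = some (q', op) := by
  have h' : ∃ r : M.State × StackOp M.Psh, M.move q x g d r.1 r.2 := ⟨(q', op), h⟩
  rw [moveFun, dif_pos h', Option.some_inj]
  exact Prod.ext (hM.unique h'.choose_spec h).1 (hM.unique h'.choose_spec h).2

end MoveFun

section FreeProduct

universe u v

variable {K : Type} {A : K → Type u} (N : ∀ k, CSPDA (A k)) (B₀ : Type)

/-- A state of one of the machines, with the index of the machine. -/
abbrev Tag := Σ k, (N k).State

/-- Pushdown stack symbols: the bottom of a syllable, which records the state to return to and the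
state in which the syllable begins; filling up to the segment of the next syllable; and the symbols
of the single machines. -/
inductive FPPsh : Type
  | bot : Option (Tag N) → Tag N → FPPsh
  | fill : FPPsh
  | sym (k : K) : (N k).Psh → FPPsh

/-- Check stack symbols: each segment consists of a mark with the entry state, a dummy symbol, and
a check stack of a single machine; the last symbol follows all segments. -/
inductive FPChk : Type
  | mark : Tag N → FPChk
  | dum : FPChk
  | sym (k : K) : (N k).Chk → FPChk
  | last : FPChk

/-- States: between segments, after the mark and inside a segment of the first stage; waiting for a
letter (with the state of the top syllable, if any); simulating a single machine; beginning a
syllable with a pending letter; going up to its segment; going down after dropping a syllable. -/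
inductive FPState : Type
  | start : FPState
  | head : Tag N → FPState
  | init (p : Tag N) : (N p.1).State → FPState
  | ret : Option (Tag N) → FPState
  | busy : Tag N → FPState
  | pend : Tag N → B₀ → FPState
  | up : B₀ → Option (Tag N) → FPState
  | down : Option (Tag N) → FPState
  | fail : FPState

section Finite

variable [Finite K]

instance : Finite (Tag N) :=
  have := fun k => (N k).finite_state
  inferInstance

instance : Finite (FPPsh N) := by
  have := fun k => (N k).finite_psh
  refine Finite.of_surjective
    (α := (Option (Tag N) × Tag N) ⊕ Unit ⊕ Σ k, (N k).Psh)
    (Sum.elim (fun p => .bot p.1 p.2) (Sum.elim (fun _ => .fill) fun p => .sym p.1 p.2)) ?_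
  rintro (⟨s, p⟩ | _ | ⟨k, g⟩)
  exacts [⟨.inl (s, p), rfl⟩, ⟨.inr (.inl ()), rfl⟩, ⟨.inr (.inr ⟨k, g⟩), rfl⟩]

instance : Finite (FPChk N) := by
  have := fun k => (N k).finite_chk
  refine Finite.of_surjective (α := Tag N ⊕ Unit ⊕ Unit ⊕ Σ k, (N k).Chk)
    (Sum.elim .mark (Sum.elim (fun _ => .dum) (Sum.elim (fun _ => .last) fun p => .sym p.1 p.2))) ?_
  rintro (p | _ | ⟨k, g⟩ | _)
  exacts [⟨.inl p, rfl⟩, ⟨.inr (.inl ()), rfl⟩, ⟨.inr (.inr (.inr ⟨k, g⟩)), rfl⟩,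
    ⟨.inr (.inr (.inl ())), rfl⟩]

instance [Finite B₀] : Finite (FPState N B₀) := by
  have := fun k => (N k).finite_state
  refine Finite.of_surjective
    (α := Bool ⊕ Tag N ⊕ (Σ p : Tag N, (N p.1).State) ⊕ Option (Tag N) ⊕ Tag N ⊕
      (Tag N × B₀) ⊕ (B₀ × Option (Tag N)) ⊕ Option (Tag N))
    (Sum.elim (fun b => if b then .start else .fail) (Sum.elim .head
      (Sum.elim (fun p => .init p.1 p.2) (Sum.elim .ret (Sum.elim .busy
      (Sum.elim (fun p => .pend p.1 p.2) (Sum.elim (fun p => .up p.1 p.2) .down))))))) ?_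
  rintro (_ | p | ⟨p, q⟩ | s | p | ⟨p, b⟩ | ⟨b, s⟩ | s | _)
  exacts [⟨.inl true, rfl⟩, ⟨.inr (.inl p), rfl⟩, ⟨.inr (.inr (.inl ⟨p, q⟩)), rfl⟩,
    ⟨.inr (.inr (.inr (.inl s))), rfl⟩, ⟨.inr (.inr (.inr (.inr (.inl p)))), rfl⟩,
    ⟨.inr (.inr (.inr (.inr (.inr (.inl (p, b)))))), rfl⟩,
    ⟨.inr (.inr (.inr (.inr (.inr (.inr (.inl (b, s))))))), rfl⟩,
    ⟨.inr (.inr (.inr (.inr (.inr (.inr (.inr s)))))), rfl⟩, ⟨.inl false, rfl⟩]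

end Finite

open Classical in
/-- The pushdown stack symbol as seen by a single machine. -/
noncomputable def viewPsh (k : K) : Option (FPPsh N) → Option (N k).Psh
  | some (.sym k' g) => if h : k' = k then some (h ▸ g) else none
  | _ => none

open Classical in
/-- The check stack symbol as seen by a single machine. -/
noncomputable def viewChk (k : K) : Option (FPChk N) → Option (N k).Chk
  | some (.sym k' d) => if h : k' = k then some (h ▸ d) else none
  | _ => none

open Classical in
/-- The state after a move of a single machine. -/
noncomputable def busyState (p : Tag N) : FPState N B₀ :=
  if p.2 = (N p.1).fail then .fail else .busy p

/-- Simulation of a move of a single machine. -/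
noncomputable def simMove (k : K) (q : (N k).State) (x : Option (A k)) (g : Option (FPPsh N))
    (d : Option (FPChk N)) : Option (FPState N B₀ × StackOp (FPPsh N)) :=
  ((N k).moveFun q x (viewPsh N k g) (viewChk N k d)).map fun r =>
    (busyState N B₀ ⟨k, r.1⟩, r.2.map (.sym k))

variable {B₀} {B : Type v} (lab : B₀ → K) (dec : ∀ k, B₀ → Option (A k)) (code : B → B₀)

open Classical in
/-- The moves of the second stage. -/
noncomputable def fpMove : FPState N B₀ → Option B → Option (FPPsh N) → Option (FPChk N) →
    Option (FPState N B₀ × StackOp (FPPsh N))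
  | .ret none, some b, _, _ => some (.up (code b) none, .keep)
  | .ret (some p), some b, g, d =>
    match dec p.1 (code b) with
    | some a => simMove N B₀ p.1 p.2 (some a) g d
    | none => some (.up (code b) (some p), .keep)
  | .busy p, none, g, d =>
    if p.2 ∈ (N p.1).reading then
      match g with
      -- Here the pushdown stack of the factor machine is empty. As the check stack never changes,
      -- equality of states means that the entry configuration is restored.
      | some (.bot s p') => if p' = p then some (.down s, .pop) else some (.ret (some p), .keep)
      | _ => some (.ret (some p), .keep)
    else simMove N B₀ p.1 p.2 none g d
  | .pend p b, none, g, d => (dec p.1 b).bind fun a => simMove N B₀ p.1 p.2 (some a) g d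
  | .up b s, none, _, d =>
    match d with
    | some (.mark p) =>
      -- The symbol `bot` comes to lie one above the mark, at the height of the dummy symbol, so
      -- that the factor machine sees the bottom of both its stacks there.
      if p.1 = lab b then some (.pend p b, .push (.bot s p)) else some (.up b s, .push .fill)
    -- Failing here keeps the search from climbing above the check stack.
    | some .last => some (.fail, .keep)
    | _ => some (.up b s, .push .fill)
  | .down s, none, g, _ =>
    match g with
    | some .fill => some (.down s, .pop)
    | _ => some (.ret s, .keep)
  | _, _, _, _ => none

/-- The moves of the first stage. -/
inductive FPInit : FPState N B₀ → Option (FPChk N) → FPState N B₀ → Prop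
  | mark (p : Tag N) : FPInit .start (some (.mark p)) (.head p)
  | dum (p : Tag N) : FPInit (.head p) (some .dum) (.init p (N p.1).start)
  | silent {p : Tag N} {q q' : (N p.1).State} : (N p.1).initMove q none q' →
      FPInit (.init p q) none (.init p q')
  | write {p : Tag N} {q q' : (N p.1).State} {d : (N p.1).Chk} : (N p.1).initMove q (some d) q' →
      FPInit (.init p q) (some (.sym p.1 d)) (.init p q')
  | finish {p : Tag N} : p.2 ∈ (N p.1).entry → FPInit (.init p p.2) none .start
  | last : FPInit .start (some .last) (.ret none)

/-- The machine for the free product. -/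
noncomputable def freeProduct [Finite K] [Finite B₀] : CSPDA B where
  State := FPState N B₀
  Chk := FPChk N
  Psh := FPPsh N
  finite_state := inferInstance
  finite_chk := inferInstance
  finite_psh := inferInstance
  start := .start
  initMove := FPInit N
  entry := {.ret none}
  accept := {q | ∃ p, q = .ret (some p)}
  reading := {q | ∃ s, q = .ret s}
  fail := .fail
  move q x g d q' op := fpMove N lab dec code q x g d = some (q', op)
  move_reading := by
    intro q x g d q' op h
    rcases q with _ | _ | _ | (_ | _) | _ | _ | _ | _ | _ <;> cases x <;> simp [fpMove] at h ⊢
  fail_not_accept := by simp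
  fail_not_reading := by simp
  fail_no_move := by
    intro x g d q' op h
    simp [fpMove] at h

variable [Finite K] [Finite B₀]

theorem freeProduct_deterministic : (freeProduct N lab dec code).Deterministic := by
  refine ⟨fun {q x g d q₁ op₁ q₂ op₂} h₁ h₂ => ?_⟩
  have h₁ : fpMove N lab dec code q x g d = some (q₁, op₁) := h₁
  have h₂ : fpMove N lab dec code q x g d = some (q₂, op₂) := h₂
  exact Prod.mk.inj (Option.some.inj (h₁.symm.trans h₂))

/-- A configuration of the machine for the free product. -/
def cfg (q : FPState N B₀) (l : List (FPPsh N)) (z : List (FPChk N)) :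
    (freeProduct N lab dec code).Config :=
  ⟨q, l, z⟩

variable {N} in
/-- The check stack symbol seen by the read write head. -/
def seenChk (l : List (FPPsh N)) (z : List (FPChk N)) : Option (FPChk N) :=
  match l with
  | [] => none
  | _ :: y => z[y.length]?

variable {N lab dec code}

theorem cfg_step {q q' : FPState N B₀} {l l' : List (FPPsh N)} {z : List (FPChk N)}
    {x : Option B} {op : StackOp (FPPsh N)}
    (h : fpMove N lab dec code q x l.head? (seenChk l z) = some (q', op))
    (hop : op.apply l = some l') :
    (freeProduct N lab dec code).Step (cfg N lab dec code q l z) x (cfg N lab dec code q' l' z) := by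
  refine ⟨op, ?_, hop, rfl⟩
  have e : (cfg N lab dec code q l z).seen = seenChk l z := by
    cases l <;> rfl
  rw [e]
  exact h

theorem within_cfg (q : FPState N B₀) {l : List (FPPsh N)} {z : List (FPChk N)}
    (h : l.length ≤ z.length) :
    (freeProduct N lab dec code).Within (cfg N lab dec code q l z) :=
  Or.inl h

theorem within_cfg_fail (l : List (FPPsh N)) (z : List (FPChk N)) :
    (freeProduct N lab dec code).Within (cfg N lab dec code .fail l z) :=
  Or.inr rfl

variable (N lab dec code)

/-! ### Entry configurations -/

/-- The segment of the check stack for a configuration of a single machine. -/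
def segWord (y : Σ k, (N k).Config) : List (FPChk N) :=
  .mark ⟨y.1, y.2.state⟩ :: .dum :: y.2.chk.map (.sym y.1)

/-- The check stack with given segments. -/
def segChk (S : List (Σ k, (N k).Config)) : List (FPChk N) :=
  S.flatMap (segWord N) ++ [.last]

variable {N}

/-- The check stacks that the first stage can produce from given segments. -/
def InitWord (S : List (Σ k, (N k).Config)) : FPState N B₀ → List (FPChk N) → Prop
  | .start, z => z = S.flatMap (segWord N)
  | .head p, z => z = S.flatMap (segWord N) ++ [.mark p]
  | .init p q, z => ∃ z', (N p.1).Init q z' ∧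
      z = S.flatMap (segWord N) ++ .mark p :: .dum :: z'.map (.sym p.1)
  | .ret _, z => z = segChk N S
  | _, _ => False

omit [Finite K] in
theorem append_segWord_append (l : List (FPChk N)) (p : Tag N) {k : K} (z : List (N k).Chk)
    (d : (N k).Chk) : (l ++ .mark p :: .dum :: z.map (.sym k)) ++ [.sym k d] =
      l ++ .mark p :: .dum :: (z ++ [d]).map (.sym k) := by
  simp

omit [Finite K] in
theorem flatMap_segWord_concat (S : List (Σ k, (N k).Config)) (y : Σ k, (N k).Config) :
    (S ++ [y]).flatMap (segWord N) = S.flatMap (segWord N) ++ segWord N y := by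
  simp

/-- `InitWord` is an invariant of the first stage: complete segments, followed by what the current
state says about the unfinished one. -/
theorem exists_initWord {q : (freeProduct N lab dec code).State}
    {z : List (freeProduct N lab dec code).Chk} (h : (freeProduct N lab dec code).Init q z) :
    ∃ S : List (Σ k, (N k).Config), (∀ y ∈ S, (N y.1).IsEntry y.2) ∧ InitWord S q z := by
  induction h with
  | start => exact ⟨[], List.forall_mem_nil _, rfl⟩
  | silent _ hm ih =>
    obtain ⟨S, hS, h⟩ := ih
    cases hm with
    | silent hm =>
      obtain ⟨z', h₁, rfl⟩ := h
      exact ⟨S, hS, z', h₁.silent hm, rfl⟩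
    | @finish p hm =>
      obtain ⟨z', h₁, rfl⟩ := h
      obtain ⟨y, hy, hyw⟩ : ∃ y : Σ k, (N k).Config, (N y.1).IsEntry y.2 ∧
          segWord N y = .mark p :: .dum :: z'.map (.sym p.1) :=
        ⟨⟨p.1, ⟨p.2, [], z'⟩⟩, ⟨hm, rfl, h₁⟩, rfl⟩
      refine ⟨S ++ [y], by simpa [or_imp, forall_and] using ⟨hS, hy⟩, ?_⟩
      rw [← hyw]
      exact (flatMap_segWord_concat S y).symm
  | write _ hm ih =>
    obtain ⟨S, hS, h⟩ := ih
    cases hm with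
    | mark p => subst h; exact ⟨S, hS, rfl⟩
    | dum p => subst h; exact ⟨S, hS, [], .start, List.append_assoc _ _ _⟩
    | @write p q q' d hm =>
      obtain ⟨z', h₁, rfl⟩ := h
      exact ⟨S, hS, z' ++ [d], h₁.write hm, append_segWord_append _ _ _ _⟩
    | last => subst h; exact ⟨S, hS, rfl⟩

theorem init_flatMap {S : List (Σ k, (N k).Config)} (hS : ∀ y ∈ S, (N y.1).IsEntry y.2) :
    (freeProduct N lab dec code).Init FPState.start (S.flatMap (segWord N)) := by
  induction S using List.reverseRecOn with
  | nil => exact .start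
  | append_singleton S y ih =>
    have h₀ := ih fun z hz => hS z (by simp [hz])
    obtain ⟨hy, -, hi⟩ := hS y (by simp)
    have h₁ : ∀ {q z}, (N y.1).Init q z →
        (freeProduct N lab dec code).Init (FPState.init ⟨y.1, y.2.state⟩ q)
          (S.flatMap (segWord N) ++ .mark ⟨y.1, y.2.state⟩ :: .dum :: z.map (.sym y.1)) := by
      intro q z h
      induction h with
      | start =>
        have := (h₀.write (FPInit.mark ⟨y.1, y.2.state⟩)).write (FPInit.dum ⟨y.1, y.2.state⟩)
        have e : (S.flatMap (segWord N) ++ [.mark ⟨y.1, y.2.state⟩]) ++ [.dum] =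
            S.flatMap (segWord N) ++ .mark ⟨y.1, y.2.state⟩ :: .dum :: [] :=
          List.append_assoc _ _ _
        exact e ▸ this
      | silent _ hm ih => exact ih.silent (FPInit.silent (p := ⟨y.1, y.2.state⟩) hm)
      | @write _ _ z d _ hm ih =>
        have := ih.write (FPInit.write (p := ⟨y.1, y.2.state⟩) hm)
        exact append_segWord_append _ _ _ _ ▸ this
    have h₂ := (h₁ hi).silent (FPInit.finish (p := ⟨y.1, y.2.state⟩) hy)
    exact (flatMap_segWord_concat S y).symm ▸ h₂

variable (N) in
/-- The state to return to when a given stack of syllables is left. -/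
def topTag (fs : List (Frame (Σ k, (N k).Config))) : Option (Tag N) :=
  fs.head?.map fun g => ⟨g.cur.1, g.cur.2.state⟩

/-- The pushdown stack that represents a stack of syllables, for a check stack of length `L`. -/
def framePsh (L : ℕ) : List (Frame (Σ k, (N k).Config)) → List (FPPsh N)
  | [] => []
  | f :: fs =>
    f.cur.2.psh.map (.sym f.cur.1) ++
      .bot (topTag N fs) ⟨f.seg.1, f.seg.2.state⟩ ::
      -- The difference of lengths is the index of the mark of the segment; the head sees that mark
      -- at a height one greater, up to which the stack is filled.
      (List.replicate (L - (segChk N (f.seg :: f.above)).length + 1 - (framePsh L fs).length) .fill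
        ++ framePsh L fs)

/-- The configuration that represents a stack of syllables. -/
def encode (S : List (Σ k, (N k).Config)) (fs : List (Frame (Σ k, (N k).Config))) :
    (freeProduct N lab dec code).Config :=
  cfg N lab dec code (.ret (topTag N fs)) (framePsh (segChk N S).length fs) (segChk N S)

/-- An initialisation amounts to a free choice of a finite list of entry configurations of the
factors. -/
theorem isEntry_iff {c : (freeProduct N lab dec code).Config} :
    (freeProduct N lab dec code).IsEntry c ↔
      ∃ S : List (Σ k, (N k).Config), (∀ y ∈ S, (N y.1).IsEntry y.2) ∧
        c = encode lab dec code S [] := by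
  constructor
  · rintro ⟨h₁, h₂, h₃⟩
    obtain ⟨q, psh, chk⟩ := c
    have h₁ : q = FPState.ret none := h₁
    subst h₁
    obtain ⟨S, hS, h⟩ := exists_initWord lab dec code h₃
    exact ⟨S, hS, Config.ext rfl h₂ h⟩
  · rintro ⟨S, hS, rfl⟩
    exact ⟨rfl, rfl, (init_flatMap lab dec code hS).write FPInit.last⟩

end FreeProduct

end CSPDA

/-! ### Simulation of a factor machine inside its segment. -/

namespace CSPDA

section FreeProduct

universe u v

variable {K : Type} {A : K → Type u} {N : ∀ k, CSPDA (A k)} {B₀ : Type}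
  {B : Type v} {lab : B₀ → K} {dec : ∀ k, B₀ → Option (A k)} {code : B → B₀}

theorem viewPsh_head? (k : K) (y : List (N k).Psh) (s : Option (Tag N)) (p : Tag N)
    (l : List (FPPsh N)) :
    viewPsh N k (y.map (FPPsh.sym k) ++ .bot s p :: l).head? = y.head? := by
  cases y <;> simp [viewPsh]

/-- Pushdown stacks and check stacks of a single machine as parts of longer stacks. -/
structure Embeds (low : List (FPPsh N)) (pre : List (FPChk N)) : Prop where
  length_eq : low.length = pre.length
  bot : ∃ s p l, low = .bot s p :: l
  dum : ∃ l, pre = l ++ [.dum]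

theorem Embeds.viewPsh_eq {low : List (FPPsh N)} {pre : List (FPChk N)} (h : Embeds low pre)
    {k : K} (y : List (N k).Psh) : viewPsh N k (y.map (FPPsh.sym k) ++ low).head? = y.head? := by
  obtain ⟨s, p, l, rfl⟩ := h.bot
  exact viewPsh_head? k y s p l

/-- Equal lengths of `low` and `pre` align the heights, and the dummy symbol is viewed as the
bottom. The bound `hc` keeps the head from seeing symbols of later segments. -/
theorem Embeds.viewChk_eq {low : List (FPPsh N)} {pre : List (FPChk N)} (h : Embeds low pre)
    (post : List (FPChk N)) {k : K} {c : (N k).Config} (hc : c.psh.length ≤ c.chk.length) :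
    viewChk N k (seenChk (c.psh.map (.sym k) ++ low) (pre ++ (c.chk.map (.sym k) ++ post))) =
      c.seen := by
  obtain ⟨s, p, l, rfl⟩ := h.bot
  obtain ⟨l', rfl⟩ := h.dum
  have hlen := h.length_eq
  simp only [List.length_cons, List.length_append, List.length_nil, zero_add] at hlen
  obtain ⟨q, psh, chk⟩ := c
  obtain _ | ⟨g, y⟩ := psh
  · simp only [List.map_nil, List.nil_append, seenChk, Config.seen]
    rw [List.append_assoc, List.getElem?_append_right (by lia)]
    simp [show l.length - l'.length = 0 by lia, viewChk]
  · simp only [List.length_cons] at hc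
    simp only [List.map_cons, List.cons_append, seenChk, Config.seen]
    rw [List.getElem?_append_right (by simp; lia), List.getElem?_append_left (by simp; lia)]
    have : (y.map (FPPsh.sym k) ++ FPPsh.bot s p :: l).length - (l' ++ [FPChk.dum (N := N)]).length
        = y.length := by simp; lia
    rw [this, List.getElem?_map, List.getElem?_eq_getElem (by lia)]
    simp [viewChk]

theorem _root_.StackOp.apply_map {Γ Δ : Type} (f : Γ → Δ) (op : StackOp Γ) {y y' : List Γ}
    (h : op.apply y = some y') (l : List Δ) :
    (op.map f).apply (y.map f ++ l) = some (y'.map f ++ l) := by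
  cases op with
  | keep => cases h; rfl
  | push => cases h; rfl
  | pop =>
    cases y with
    | nil => cases h
    | cons => cases h; rfl

theorem Reachable.step {A : Type*} {M : CSPDA A} {c c' : M.Config} {x : Option A}
    (h : M.Reachable c) (hs : M.Step c x c') : M.Reachable c' := by
  obtain ⟨c₀, w, h₀, hw⟩ := h
  cases x with
  | none => exact ⟨c₀, w ++ [], h₀, hw.trans (.silent hs (.refl _))⟩
  | some a => exact ⟨c₀, w ++ [a], h₀, hw.trans (.read hs (.refl _))⟩

variable [Finite K] [Finite B₀]

/-- The configuration of the machine for the free product that represents a configuration of a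
single machine. -/
def embed (lab : B₀ → K) (dec : ∀ k, B₀ → Option (A k)) (code : B → B₀) (low : List (FPPsh N))
    (pre post : List (FPChk N)) (st : FPState N B₀) {k : K} (c : (N k).Config) :
    (freeProduct N lab dec code).Config :=
  cfg N lab dec code st (c.psh.map (.sym k) ++ low) (pre ++ (c.chk.map (.sym k) ++ post))

variable {low : List (FPPsh N)} {pre post : List (FPChk N)} {k : K}

/-- A move of a single machine is simulated. -/
theorem Embeds.step (h : Embeds low pre) (hN : (N k).IsSpecial) {c c' : (N k).Config}
    {x : Option (A k)} (hs : (N k).Step c x c') (hc : c.psh.length ≤ c.chk.length)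
    {st : FPState N B₀} {x' : Option B}
    (hst : ∀ g d, fpMove N lab dec code st x' g d = simMove N B₀ k c.state x g d) :
    (freeProduct N lab dec code).Step (embed lab dec code low pre post st c) x'
      (embed lab dec code low pre post (busyState N B₀ ⟨k, c'.state⟩) c') := by
  obtain ⟨op, hm, hop, hchk⟩ := hs
  rw [embed, embed, hchk]
  refine cfg_step (op := op.map (.sym k)) ?_ (StackOp.apply_map _ _ hop _)
  rw [hst, simMove, h.viewPsh_eq, h.viewChk_eq _ hc, hN.det.moveFun_eq hm]
  rfl

theorem Embeds.within_embed (h : Embeds low pre) (post : List (FPChk N)) (st : FPState N B₀)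
    {c : (N k).Config} (hc : c.psh.length ≤ c.chk.length) :
    (freeProduct N lab dec code).Within (embed lab dec code low pre post st c) := by
  refine within_cfg _ ?_
  have := h.length_eq
  simp
  lia

theorem Embeds.within (h : Embeds low pre) (hN : (N k).IsSpecial) {c : (N k).Config}
    (hc : (N k).Reachable c) : (freeProduct N lab dec code).Within
      (embed lab dec code low pre post (busyState N B₀ ⟨k, c.state⟩) c) := by
  obtain hw | hf := hN.within c hc
  · exact h.within_embed _ _ hw
  · rw [embed, busyState, if_pos hf]
    exact within_cfg_fail _ _


theorem Embeds.run_nil (h : Embeds low pre) (hN : (N k).IsSpecial) {c c' : (N k).Config}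
    (hc : (N k).Reachable c) (hr : (N k).Run c [] c') :
    (freeProduct N lab dec code).RunIn (freeProduct N lab dec code).Within
      (embed lab dec code low pre post (busyState N B₀ ⟨k, c.state⟩) c) []
      (embed lab dec code low pre post (busyState N B₀ ⟨k, c'.state⟩) c') := by
  generalize hw : ([] : List (A k)) = w at hr
  induction hr with
  | refl => exact .refl (h.within hN hc)
  | @silent c _ _ _ hs _ ih =>
    have hle := (hN.within c hc).resolve_right hs.state_ne_fail
    refine .silent (h.within hN hc) (h.step hN hs hle ?_) (ih (hc.step hs) hw)
    intro g d
    simp [busyState, hs.state_ne_fail, fpMove, hs.notMem_reading]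
  | read => simp at hw

/-- The processing of a letter by a single machine is simulated. -/
theorem Embeds.run_letter (h : Embeds low pre) (hN : (N k).IsSpecial) {c c' : (N k).Config}
    (hc : (N k).Reachable c) {a : A k} (hr : (N k).Run c [a] c') (hrd : c.state ∈ (N k).reading)
    {st : FPState N B₀} {x' : Option B}
    (hst : ∀ g d, fpMove N lab dec code st x' g d = simMove N B₀ k c.state (some a) g d) :
    (freeProduct N lab dec code).RunIn (freeProduct N lab dec code).Within
      (embed lab dec code low pre post st c) x'.toList
      (embed lab dec code low pre post (busyState N B₀ ⟨k, c'.state⟩) c') := by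
  cases hr with
  | silent hs => exact absurd hrd hs.notMem_reading
  | read hs hr =>
    have hle := (hN.within c hc).resolve_right hs.state_ne_fail
    have hs' := h.step (post := post) hN hs hle hst
    have hW : (freeProduct N lab dec code).Within (embed lab dec code low pre post st c) := by
      exact h.within_embed _ _ hle
    have hr' := h.run_nil (lab := lab) (dec := dec) (code := code) (post := post) hN
      (hc.step hs) hr
    cases x' with
    | none => exact .silent hW hs' hr'
    | some b => exact .read hW hs' hr'

/-! ### Going up and down -/

/-- The check stack symbols that are passed in search of a segment for the letter `b`. -/
def Passes (lab : B₀ → K) (b : B₀) (x : FPChk N) : Prop :=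
  x ≠ .last ∧ ∀ p, x = .mark p → p.1 ≠ lab b

omit [Finite K] [Finite B₀] in
theorem fpMove_up {b : B₀} {s : Option (Tag N)} {d : Option (FPChk N)}
    (hd : ∀ x, d = some x → Passes lab b x) (g : Option (FPPsh N)) :
    fpMove N lab dec code (.up b s) none g d = some (.up b s, .push .fill) := by
  obtain _ | (p | _ | _ | _) := d
  · rfl
  · have := (hd _ rfl).2 p rfl
    simp [fpMove, this]
  · rfl
  · rfl
  · exact absurd rfl (hd _ rfl).1

/-- At height `i + 1` the head sees index `i`. Only the heights that are left by a push need symbols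
that are passed; the symbol at the final height is arbitrary. -/
theorem run_up {b : B₀} {s : Option (Tag N)} {l : List (FPPsh N)} {z : List (FPChk N)} {j : ℕ}
    (hj : l.length + j ≤ z.length)
    (hpass : ∀ i x, l.length ≤ i + 1 → i + 1 < l.length + j → z[i]? = some x → Passes lab b x) :
    (freeProduct N lab dec code).RunIn (freeProduct N lab dec code).Within
      (cfg N lab dec code (.up b s) l z) []
      (cfg N lab dec code (.up b s) (List.replicate j .fill ++ l) z) := by
  induction j with
  | zero => exact .refl (within_cfg _ hj)
  | succ j ih =>
    have hlen : (List.replicate j (FPPsh.fill (N := N)) ++ l).length = l.length + j := by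
      simp; lia
    have ih := ih (by lia) fun i x h₁ h₂ => hpass i x h₁ (by lia)
    rw [List.replicate_succ, List.cons_append]
    generalize List.replicate j (FPPsh.fill (N := N)) ++ l = m at ih hlen
    refine ih.trans (v := []) (.silent (within_cfg _ (by lia))
      (cfg_step (op := .push .fill) (fpMove_up ?_ _) rfl) (.refl (within_cfg _ ?_)))
    · intro x hx
      cases m with
      | nil => cases hx
      | cons g m =>
        simp only [List.length_cons] at hlen
        exact hpass m.length x (by lia) (by lia) hx
    · simp
      lia

theorem run_down {s : Option (Tag N)} {l : List (FPPsh N)} {z : List (FPChk N)} {j : ℕ}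
    (hj : l.length + j ≤ z.length) (hl : l.head? ≠ some .fill) :
    (freeProduct N lab dec code).RunIn (freeProduct N lab dec code).Within
      (cfg N lab dec code (.down s) (List.replicate j .fill ++ l) z) []
      (cfg N lab dec code (.ret s) l z) := by
  induction j with
  | zero =>
    refine .silent (within_cfg _ hj) (cfg_step (op := .keep) ?_ rfl) (.refl (within_cfg _ hj))
    change fpMove N lab dec code (.down s) none l.head? _ = _
    generalize l.head? = g at hl
    obtain _ | (_ | _ | _) := g
    · rfl
    · rfl
    · exact absurd rfl hl
    · rfl
  | succ j ih =>
    refine .silent (within_cfg _ (by simp; lia)) (cfg_step (op := .pop) rfl rfl) (ih (by lia))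

end FreeProduct

end CSPDA

/-! ### The action on segments, and the machine as a realisation of the action on stacks of
syllables. -/

namespace CSPDA

section FreeProduct

universe u v

variable {K : Type} {A : K → Type u} {N : ∀ k, CSPDA (A k)} {B₀ : Type}
  {B : Type v} {lab : B₀ → K} {dec : ∀ k, B₀ → Option (A k)} {code : B → B₀}

/-- The partial action of letters on configurations of the single machines. -/
noncomputable def segAct (N : ∀ k, CSPDA (A k)) (dec : ∀ k, B₀ → Option (A k)) (code : B → B₀)
    (y : Σ k, (N k).Config) (b : B) : Option (Σ k, (N k).Config) :=
  (dec y.1 (code b)).bind fun a => ((N y.1).letterAct y.2 a).map (Sigma.mk y.1)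

theorem wordAct_segAct (hdec : ∀ k b, (dec k b).isSome ↔ lab b = k) {k : K} (c : (N k).Config)
    {w : List B} (hw : ∀ b ∈ w, lab (code b) = k) :
    wordAct (segAct N dec code) ⟨k, c⟩ w =
      (wordAct (N k).letterAct c (w.filterMap fun b => dec k (code b))).map (Sigma.mk k) := by
  induction w generalizing c with
  | nil => rfl
  | cons b w ih =>
    obtain ⟨hb, hw⟩ := List.forall_mem_cons.1 hw
    obtain ⟨a, ha⟩ := Option.isSome_iff_exists.1 ((hdec k _).2 hb)
    rw [wordAct_cons, segAct, ha, List.filterMap_cons_some (f := fun b => dec k (code b)) ha, wordAct_cons]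
    simp only [Option.bind_some]
    cases (N k).letterAct c a with
    | none => rfl
    | some c' => simpa using ih c' hw

theorem exists_after_of_inOrbit (hdec : ∀ k b, (dec k b).isSome ↔ lab b = k)
    (hN : ∀ k, (N k).IsSpecial) {k : K} {e : (N k).Config} (he : (N k).IsEntry e)
    {y : Σ k, (N k).Config}
    (h : InOrbit Sigma.fst (fun b => lab (code b)) (segAct N dec code) ⟨k, e⟩ y) :
    ∃ c u, y = ⟨k, c⟩ ∧ (N k).After e u c := by
  obtain ⟨u, hu, h⟩ := h
  rw [wordAct_segAct hdec e hu] at h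
  obtain ⟨c, hc, rfl⟩ := Option.map_eq_some_iff.1 h
  exact ⟨c, _, rfl, ((hN k).det.wordAct_eq_some_iff ((hN k).entry_reading e he)).1 hc⟩

/-! ### The layout of the stacks -/

theorem segChk_append (l l' : List (Σ k, (N k).Config)) :
    segChk N (l ++ l') = l.flatMap (segWord N) ++ segChk N l' := by
  simp [segChk]

theorem segChk_cons (y : Σ k, (N k).Config) (l : List (Σ k, (N k).Config)) :
    segChk N (y :: l) = .mark ⟨y.1, y.2.state⟩ :: .dum :: (y.2.chk.map (.sym y.1) ++ segChk N l) := by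
  simp [segChk, segWord]

/-- Symbols that are passed when the label `k` is searched. -/
def PassesLabel (k : K) (x : FPChk N) : Prop :=
  x ≠ .last ∧ ∀ p, x = .mark p → p.1 ≠ k

theorem passesLabel_flatMap {k : K} {l : List (Σ k, (N k).Config)} (h : ∀ z ∈ l, z.1 ≠ k)
    {x : FPChk N} (hx : x ∈ l.flatMap (segWord N)) : PassesLabel k x := by
  obtain ⟨z, hz, hx⟩ := List.mem_flatMap.1 hx
  simp only [segWord, List.mem_cons, List.mem_map] at hx
  obtain rfl | rfl | ⟨d, -, rfl⟩ := hx
  · exact ⟨by simp, fun p hp => by cases hp; exact h z hz⟩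
  · exact ⟨by simp, by simp⟩
  · exact ⟨by simp, by simp⟩

/-- The pushdown stack below the symbols of a syllable. -/
def lowPsh (L : ℕ) (y : Σ k, (N k).Config) (ys : List (Σ k, (N k).Config))
    (fs : List (Frame (Σ k, (N k).Config))) : List (FPPsh N) :=
  .bot (topTag N fs) ⟨y.1, y.2.state⟩ ::
    (List.replicate (L - (segChk N (y :: ys)).length + 1 - (framePsh L fs).length) .fill
      ++ framePsh L fs)

theorem framePsh_cons (L : ℕ) (f : Frame (Σ k, (N k).Config))
    (fs : List (Frame (Σ k, (N k).Config))) :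
    framePsh L (f :: fs) = f.cur.2.psh.map (.sym f.cur.1) ++ lowPsh L f.seg f.above fs :=
  rfl

theorem head?_framePsh_ne (L : ℕ) (fs : List (Frame (Σ k, (N k).Config))) :
    (framePsh L fs).head? ≠ some .fill := by
  cases fs with
  | nil => simp [framePsh]
  | cons f fs =>
    rw [framePsh_cons, lowPsh]
    cases f.cur.2.psh <;> simp

/-- The head is on a part of the check stack below the available segments, and on its way up to
these it meets no marks. -/
def Layout (S : List (Σ k, (N k).Config)) (fs : List (Frame (Σ k, (N k).Config))) : Prop :=
  ∃ pre mid, segChk N S = pre ++ mid ++ segChk N (room S fs) ∧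
    pre.length = (framePsh (segChk N S).length fs).length - 1 ∧
    (framePsh (segChk N S).length fs).length ≤ (pre ++ mid).length ∧
    ∀ x ∈ mid, ∀ k, PassesLabel k x

theorem Layout.passes {S : List (Σ k, (N k).Config)} {fs : List (Frame (Σ k, (N k).Config))}
    (h : Layout S fs) {k : K} {l l' : List (Σ k, (N k).Config)} (hl : room S fs = l ++ l')
    (hk : ∀ z ∈ l, z.1 ≠ k) : ∃ Z, segChk N S = Z ++ segChk N l' ∧
      (framePsh (segChk N S).length fs).length ≤ Z.length ∧
      ∀ i x, (framePsh (segChk N S).length fs).length ≤ i + 1 → i < Z.length →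
        (segChk N S)[i]? = some x → PassesLabel k x := by
  obtain ⟨pre, mid, h₁, h₂, h₃, h₄⟩ := h
  rw [hl, segChk_append, ← List.append_assoc] at h₁
  refine ⟨_, h₁, by rw [List.length_append]; lia, fun i x hi hi' hx => ?_⟩
  rw [h₁, List.getElem?_append_left hi', List.append_assoc,
    List.getElem?_append_right (by lia)] at hx
  obtain hx | hx := List.mem_append.1 (List.mem_of_getElem? hx)
  · exact h₄ x hx k
  · exact passesLabel_flatMap hk hx

theorem Layout.opens [DecidableEq K] {S : List (Σ k, (N k).Config)} {fs : List (Frame (Σ k, (N k).Config))}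
    (h : Layout S fs) {y : Σ k, (N k).Config} {ys : List (Σ k, (N k).Config)}
    (ho : Opens Sigma.fst S fs y ys) :
    ∃ Z, segChk N S = (Z ++ [.mark ⟨y.1, y.2.state⟩] ++ [.dum]) ++
        (y.2.chk.map (.sym y.1) ++ segChk N ys) ∧
      lowPsh (segChk N S).length y ys fs = .bot (topTag N fs) ⟨y.1, y.2.state⟩ ::
        (List.replicate (Z.length + 1 - (framePsh (segChk N S).length fs).length) .fill
          ++ framePsh (segChk N S).length fs) ∧
      (framePsh (segChk N S).length fs).length ≤ Z.length ∧
      Embeds (lowPsh (segChk N S).length y ys fs) (Z ++ [.mark ⟨y.1, y.2.state⟩] ++ [.dum]) ∧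
      ∀ i x, (framePsh (segChk N S).length fs).length ≤ i + 1 → i < Z.length →
        (segChk N S)[i]? = some x → PassesLabel y.1 x := by
  obtain ⟨-, l, hl, hk⟩ := findSeg_eq_some ho.find
  obtain ⟨Z, h₁, h₂, h₃⟩ := h.passes hl hk
  have hlow : lowPsh (segChk N S).length y ys fs = .bot (topTag N fs) ⟨y.1, y.2.state⟩ ::
        (List.replicate (Z.length + 1 - (framePsh (segChk N S).length fs).length) .fill
          ++ framePsh (segChk N S).length fs) := by
    have : (segChk N S).length - (segChk N (y :: ys)).length = Z.length := by
      rw [h₁, List.length_append]; lia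
    rw [lowPsh, this]
  refine ⟨Z, by rw [h₁, segChk_cons]; simp, hlow, h₂, ⟨?_, ⟨_, _, _, rfl⟩, ⟨_, rfl⟩⟩, h₃⟩
  rw [hlow]
  simp
  lia

variable [DecidableEq K] (hdec : ∀ k b, (dec k b).isSome ↔ lab b = k)
  (hN : ∀ k, (N k).IsSpecial) {S : List (Σ k, (N k).Config)} (hS : ∀ y ∈ S, (N y.1).IsEntry y.2)

include hdec hN hS

/-- The top syllable is in a reachable reading configuration, so (2) for its factor keeps the head
between the dummy symbol and the end of its segment, a stretch without marks. -/
theorem layout_of_validFrames {fs : List (Frame (Σ k, (N k).Config))}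
    (h : ValidFrames Sigma.fst (fun b => lab (code b)) (segAct N dec code) S fs) :
    Layout S fs := by
  induction h with
  | nil => exact ⟨[], [], by simp [room], by simp [framePsh], by simp [framePsh], by simp⟩
  | @cons f fs h ho hc _ ih =>
    obtain ⟨⟨k, e⟩, cur, ys⟩ := f
    obtain ⟨c, u, rfl, hu⟩ := exists_after_of_inOrbit hdec hN (hS ⟨k, e⟩ (h.mem ho))
      (y := cur) hc
    obtain ⟨Z, h₁, h₂, h₃, h₄, -⟩ := ih.opens ho
    have hlen := h₄.length_eq
    have hle : c.psh.length ≤ c.chk.length :=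
      ((hN k).within c ⟨e, u, hS _ (h.mem ho), hu.1⟩).resolve_right (ne_fail_of_reading hu.2)
    rw [hu.1.chk_eq] at hle
    -- In the dummy symbol followed by the factor's check stack, the head is at index
    -- `c.psh.length`; the first part ends just below it.
    refine ⟨Z ++ [.mark ⟨k, e.state⟩] ++ (.dum :: e.chk.map (.sym k)).take c.psh.length,
      (.dum :: e.chk.map (.sym k)).drop c.psh.length, ?_, ?_, ?_, ?_⟩
    · rw [List.append_assoc (Z ++ _), List.take_append_drop, h₁]
      simp [room]
    · rw [framePsh_cons]
      simp only [List.length_append, List.length_map, hlen, List.length_take, List.length_cons,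
        List.length_nil]
      lia
    · rw [framePsh_cons]
      simp only [List.length_append, List.length_map, hlen, List.length_take, List.length_cons,
        List.length_nil, List.length_drop]
      lia
    · intro x hx k'
      have := List.mem_of_mem_drop hx
      simp only [List.mem_cons, List.mem_map] at this
      obtain rfl | ⟨d, -, rfl⟩ := this
      · exact ⟨by simp, by simp⟩
      · exact ⟨by simp, by simp⟩

variable [Finite K] [Finite B₀]

/-! ### Big steps -/

theorem run_begin {fs : List (Frame (Σ k, (N k).Config))}
    (h : ValidFrames Sigma.fst (fun b => lab (code b)) (segAct N dec code) S fs) {b : B}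
    (htop : ∀ f ∈ fs.head?, f.seg.1 ≠ lab (code b)) :
    (freeProduct N lab dec code).RunIn (freeProduct N lab dec code).Within
      (encode lab dec code S fs) [b] (cfg N lab dec code (.up (code b) (topTag N fs))
        (framePsh (segChk N S).length fs) (segChk N S)) := by
  have hle : (framePsh (segChk N S).length fs).length ≤ (segChk N S).length := by
    obtain ⟨pre, mid, h₁, -, h₃, -⟩ := layout_of_validFrames hdec hN hS h
    refine h₃.trans ?_
    have := congrArg List.length h₁
    rw [List.length_append] at this
    lia
  refine .read (within_cfg _ hle) (cfg_step (op := .keep) ?_ rfl) (.refl (within_cfg _ hle))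
  cases h with
  | nil => rfl
  | @cons f fs h ho hc =>
    obtain ⟨⟨k, e⟩, cur, ys⟩ := f
    obtain ⟨c, u, rfl, hu⟩ := exists_after_of_inOrbit hdec hN (hS ⟨k, e⟩ (h.mem ho))
      (y := cur) hc
    have : dec k (code b) = none := by
      rw [← Option.not_isSome_iff_eq_none, hdec]
      exact (htop _ rfl).symm
    simp [topTag, fpMove, this]

theorem run_open {fs : List (Frame (Σ k, (N k).Config))}
    (h : ValidFrames Sigma.fst (fun b => lab (code b)) (segAct N dec code) S fs) {b : B}
    {y : Σ k, (N k).Config} {ys : List (Σ k, (N k).Config)} (ho : Opens Sigma.fst S fs y ys)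
    (hb : lab (code b) = y.1) :
    (freeProduct N lab dec code).RunIn (freeProduct N lab dec code).Within
      (encode lab dec code S fs) [b] (cfg N lab dec code (.pend ⟨y.1, y.2.state⟩ (code b))
        (lowPsh (segChk N S).length y ys fs) (segChk N S)) := by
  have h₀ := run_begin hdec hN hS h (b := b) (hb ▸ ho.top_ne)
  obtain ⟨Z, h₁, h₂, h₃, -, h₄⟩ := (layout_of_validFrames hdec hN hS h).opens ho
  have hL : Z.length + 2 ≤ (segChk N S).length := by
    rw [h₁]; simp
  have hup := run_up (lab := lab) (dec := dec) (code := code) (b := code b) (s := topTag N fs)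
    (l := framePsh (segChk N S).length fs) (z := segChk N S)
    (j := Z.length + 1 - (framePsh (segChk N S).length fs).length) (by lia)
    (fun i x hi hi' hx => by rw [Passes, hb]; exact h₄ i x hi (by lia) hx)
  have hlen : (List.replicate (Z.length + 1 - (framePsh (segChk N S).length fs).length) FPPsh.fill
      ++ framePsh (segChk N S).length fs).length = Z.length + 1 := by
    simp; lia
  rw [h₂]
  generalize List.replicate (Z.length + 1 - (framePsh (segChk N S).length fs).length) FPPsh.fill
      ++ framePsh (segChk N S).length fs = m at hup hlen
  refine h₀.trans (v := []) (hup.trans (v := []) (.silent (within_cfg _ (by lia))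
    (cfg_step (op := .push (.bot (topTag N fs) ⟨y.1, y.2.state⟩)) ?_ rfl)
    (.refl (within_cfg _ (by simp; lia)))))
  cases m with
  | nil => simp at hlen
  | cons g m =>
    have hm : m.length = Z.length := by simpa using hlen
    have : seenChk (g :: m) (segChk N S) = some (.mark ⟨y.1, y.2.state⟩) := by
      rw [seenChk, h₁, hm]
      simp
    rw [this]
    simp [fpMove, hb]

/-- The machine tests only the state and the emptiness of the factor's pushdown stack. This decides
whether `c = e`, because a run preserves the check stack. -/
theorem run_settle {fs : List (Frame (Σ k, (N k).Config))}
    (h : ValidFrames Sigma.fst (fun b => lab (code b)) (segAct N dec code) S fs) {k : K}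
    {e c : (N k).Config} {ys : List (Σ k, (N k).Config)} (ho : Opens Sigma.fst S fs ⟨k, e⟩ ys)
    {u : List (A k)} (hc : (N k).After e u c) :
    (freeProduct N lab dec code).RunIn (freeProduct N lab dec code).Within
      (cfg N lab dec code (busyState N B₀ ⟨k, c.state⟩)
        (c.psh.map (.sym k) ++ lowPsh (segChk N S).length ⟨k, e⟩ ys fs) (segChk N S)) []
      (encode lab dec code S (settle ⟨k, e⟩ ys fs ⟨k, c⟩)) := by
  obtain ⟨Z, h₁, h₂, h₃, h₄, -⟩ := (layout_of_validFrames hdec hN hS h).opens ho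
  have he : (N k).IsEntry e := hS _ (h.mem ho)
  have hcr : (N k).Reachable c := ⟨e, u, he, hc.1⟩
  have hle : c.psh.length ≤ e.chk.length := by
    rw [← hc.1.chk_eq]
    exact ((hN k).within c hcr).resolve_right (ne_fail_of_reading hc.2)
  have hlen := h₄.length_eq
  have hL : (c.psh.map (FPPsh.sym k) ++ lowPsh (segChk N S).length ⟨k, e⟩ ys fs).length ≤
      (segChk N S).length := by
    have := congrArg List.length h₁
    rw [List.length_append, hlen, List.length_map]
    simp only [List.length_append, List.length_map] at this ⊢
    lia
  rw [busyState, if_neg (ne_fail_of_reading hc.2)]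
  by_cases hce : c = e
  · subst hce
    obtain ⟨-, hpsh, -⟩ := he
    rw [settle_self]
    rw [hpsh, List.map_nil, List.nil_append] at hL ⊢
    rw [h₂] at hL ⊢
    rw [List.length_cons, List.length_append, List.length_replicate] at hL
    refine .silent (within_cfg _ (by simp; lia)) (cfg_step (op := .pop) ?_ rfl)
      (run_down (by lia) (head?_framePsh_ne _ _))
    simp [fpMove, hc.2]
  · rw [settle_of_ne (by simpa using hce)]
    refine .silent (within_cfg _ hL) (cfg_step (op := .keep) ?_ rfl) (.refl (within_cfg _ hL))
    cases hpsh : c.psh with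
    | nil =>
      have hne : e.state ≠ c.state := fun h' =>
        hce (Config.ext h'.symm (hpsh.trans he.2.1.symm) hc.1.chk_eq)
      simp [fpMove, hc.2, lowPsh, topTag, hne]
    | cons g l => simp [fpMove, hc.2, topTag]

/-- The pair `st`, `x` covers both a letter read in an active syllable and a pending letter (`x =
none`) in a syllable just opened. -/
theorem run_active (hnil : ∀ k, [] ∉ (N k).language) {fs : List (Frame (Σ k, (N k).Config))}
    (h : ValidFrames Sigma.fst (fun b => lab (code b)) (segAct N dec code) S fs) {k : K}
    {e c : (N k).Config} {ys : List (Σ k, (N k).Config)} (ho : Opens Sigma.fst S fs ⟨k, e⟩ ys)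
    {u : List (A k)} (hc : (N k).After e u c) {a : A k} {st : FPState N B₀} {x : Option B}
    (hst : ∀ g d, fpMove N lab dec code st x g d = simMove N B₀ k c.state (some a) g d) :
    (∀ c', (N k).letterAct c a = some c' →
      (freeProduct N lab dec code).RunIn (freeProduct N lab dec code).Within
        (cfg N lab dec code st
          (c.psh.map (.sym k) ++ lowPsh (segChk N S).length ⟨k, e⟩ ys fs) (segChk N S))
        x.toList (encode lab dec code S (settle ⟨k, e⟩ ys fs ⟨k, c'⟩))) ∧
    ((N k).letterAct c a = none → ∃ c',
      (freeProduct N lab dec code).RunIn (freeProduct N lab dec code).Within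
        (cfg N lab dec code st
          (c.psh.map (.sym k) ++ lowPsh (segChk N S).length ⟨k, e⟩ ys fs) (segChk N S))
        x.toList c' ∧ c'.state = (freeProduct N lab dec code).fail) := by
  obtain ⟨Z, h₁, h₂, h₃, h₄, -⟩ := (layout_of_validFrames hdec hN hS h).opens ho
  have he : (N k).IsEntry e := hS _ (h.mem ho)
  have hcr : (N k).Reachable c := ⟨e, u, he, hc.1⟩
  have hemb : ∀ (q : FPState N B₀) (d : (N k).Config), d.chk = e.chk →
      embed lab dec code (lowPsh (segChk N S).length ⟨k, e⟩ ys fs)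
        (Z ++ [.mark ⟨k, e.state⟩] ++ [.dum]) (segChk N ys) q d =
      cfg N lab dec code q
        (d.psh.map (.sym k) ++ lowPsh (segChk N S).length ⟨k, e⟩ ys fs) (segChk N S) := by
    intro q d hd
    rw [embed, hd, ← h₁]
  constructor
  · intro c' hc'
    have hc' := after_of_letterAct hc'
    have hrun := h₄.run_letter (post := segChk N ys) (hN k) hcr hc'.1 hc.2 hst
    rw [hemb _ _ hc.1.chk_eq, hemb _ _ (hc'.1.chk_eq.trans hc.1.chk_eq)] at hrun
    have hu : (N k).After e (u ++ [a]) c' := ⟨hc.1.trans hc'.1, hc'.2⟩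
    have := hrun.trans (run_settle (lab := lab) (dec := dec) (code := code) hdec hN hS h ho hu)
    rwa [List.append_nil] at this
  · intro hnone
    have hr := (hN k).entry_reading e he
    obtain ⟨c', hc', hf⟩ := (hN k).fails_of_letterAct_eq_none (hnil k) he
      (((hN k).det.wordAct_eq_some_iff hr).2 hc) hnone
    have hrun := h₄.run_letter (post := segChk N ys) (hN k) hcr hc' hc.2 hst
    rw [hemb _ _ hc.1.chk_eq] at hrun
    refine ⟨_, hrun, ?_⟩
    change busyState N B₀ ⟨k, c'.state⟩ = .fail
    rw [busyState, if_pos hf]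

theorem run_frameAct (hnil : ∀ k, [] ∉ (N k).language)
    {fs : List (Frame (Σ k, (N k).Config))}
    (h : ValidFrames Sigma.fst (fun b => lab (code b)) (segAct N dec code) S fs) (b : B) :
    (∀ fs', frameAct Sigma.fst (fun b => lab (code b)) (segAct N dec code) S fs b = some fs' →
      (freeProduct N lab dec code).RunIn (freeProduct N lab dec code).Within
        (encode lab dec code S fs) [b] (encode lab dec code S fs')) ∧
    (frameAct Sigma.fst (fun b => lab (code b)) (segAct N dec code) S fs b = none → ∃ c',
      (freeProduct N lab dec code).RunIn (freeProduct N lab dec code).Within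
        (encode lab dec code S fs) [b] c' ∧ c'.state = (freeProduct N lab dec code).fail) := by
  obtain ⟨⟨k, e⟩, ys, fs, y, h', ho, hy, he, rfl⟩ | ⟨hf, htop⟩ := h.exists_settle (lab (code b))
  · have hent : (N k).IsEntry e := hS _ (h'.mem ho)
    obtain ⟨c, u, rfl, hu⟩ := exists_after_of_inOrbit hdec hN hent he
    simp only at hy
    obtain ⟨a, ha⟩ := Option.isSome_iff_exists.1 ((hdec k _).2 hy.symm)
    have hact : segAct N dec code ⟨k, c⟩ b = ((N k).letterAct c a).map (Sigma.mk k) := by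
      simp [segAct, ha]
    have key : ∀ C, (∀ c', (N k).letterAct c a = some c' →
        (freeProduct N lab dec code).RunIn (freeProduct N lab dec code).Within C [b]
          (encode lab dec code S (settle ⟨k, e⟩ ys fs ⟨k, c'⟩))) ∧
        ((N k).letterAct c a = none → ∃ c',
          (freeProduct N lab dec code).RunIn (freeProduct N lab dec code).Within C [b] c' ∧
          c'.state = (freeProduct N lab dec code).fail) →
        C = encode lab dec code S (settle ⟨k, e⟩ ys fs ⟨k, c⟩) →
        (∀ fs', frameAct Sigma.fst (fun b => lab (code b)) (segAct N dec code) S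
            (settle ⟨k, e⟩ ys fs ⟨k, c⟩) b = some fs' →
          (freeProduct N lab dec code).RunIn (freeProduct N lab dec code).Within
          (encode lab dec code S (settle ⟨k, e⟩ ys fs ⟨k, c⟩)) [b] (encode lab dec code S fs')) ∧
        (frameAct Sigma.fst (fun b => lab (code b)) (segAct N dec code) S
            (settle ⟨k, e⟩ ys fs ⟨k, c⟩) b = none → ∃ c',
          (freeProduct N lab dec code).RunIn (freeProduct N lab dec code).Within
            (encode lab dec code S (settle ⟨k, e⟩ ys fs ⟨k, c⟩)) [b] c' ∧
          c'.state = (freeProduct N lab dec code).fail) := by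
      rintro C ⟨hC, hC'⟩ rfl
      rw [ho.frameAct_settle (lab := fun b => lab (code b)) _ hy.symm, hact]
      constructor
      · intro fs' hfs
        simp only [Option.map_map, Option.map_eq_some_iff] at hfs
        obtain ⟨c', hc', rfl⟩ := hfs
        exact hC c' hc'
      · intro hnone
        simp only [Option.map_map, Option.map_eq_none_iff] at hnone
        exact hC' hnone
    -- If `c = e` the syllable is absent from the stack and has to be opened before the pending
    -- letter is processed.
    by_cases hce : c = e
    · subst hce
      have hopen := run_open hdec hN hS h' ho hy.symm
      obtain ⟨hA, hA'⟩ := run_active (lab := lab) (dec := dec) (code := code) hdec hN hS hnil h' ho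
        hu (a := a) (st := .pend ⟨k, c.state⟩ (code b)) (x := none) (by simp [fpMove, ha])
      rw [hent.2.1] at hA hA'
      refine key _ ⟨fun c' hc' => hopen.trans (v := []) (hA c' hc'), fun hnone => ?_⟩
        (by rw [settle_self])
      obtain ⟨c', hc', hf⟩ := hA' hnone
      exact ⟨c', hopen.trans (v := []) hc', hf⟩
    · refine key _ (run_active (lab := lab) (dec := dec) (code := code) hdec hN hS hnil h' ho
        hu (a := a) (st := .ret (some ⟨k, c.state⟩)) (x := some b) (by simp [fpMove, ha])) ?_
      rw [settle_of_ne (by simpa using hce)]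
      rfl
  · rw [frameAct_eq_openFrame (lab := fun b => lab (code b)) htop,
      openFrame_eq_none (lab := fun b => lab (code b)) hf]
    refine ⟨by simp, fun _ => ?_⟩
    have h₀ := run_begin hdec hN hS h htop
    obtain ⟨Z, h₁, h₂, h₃⟩ := (layout_of_validFrames hdec hN hS h).passes
      (List.append_nil _).symm (findSeg_eq_none hf)
    -- No available segment has the label, so the search climbs to the last symbol and fails there.
    have h₁ : segChk N S = Z ++ [.last] := h₁
    have hL : (segChk N S).length = Z.length + 1 := by rw [h₁]; simp
    have hup := run_up (lab := lab) (dec := dec) (code := code) (b := code b) (s := topTag N fs)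
      (l := framePsh (segChk N S).length fs) (z := segChk N S)
      (j := Z.length + 1 - (framePsh (segChk N S).length fs).length) (by lia)
      (fun i x hi hi' hx => h₃ i x hi (by lia) hx)
    have hlen : (List.replicate (Z.length + 1 - (framePsh (segChk N S).length fs).length) FPPsh.fill
        ++ framePsh (segChk N S).length fs).length = Z.length + 1 := by
      simp; lia
    generalize List.replicate (Z.length + 1 - (framePsh (segChk N S).length fs).length) FPPsh.fill
        ++ framePsh (segChk N S).length fs = m at hup hlen
    refine ⟨cfg N lab dec code .fail m (segChk N S), h₀.trans (v := []) (hup.trans (v := [])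
      (.silent (within_cfg _ (by lia)) (cfg_step (op := .keep) ?_ rfl)
      (.refl (within_cfg_fail _ _)))), rfl⟩
    cases m with
    | nil => simp at hlen
    | cons g m =>
      have hm : m.length = Z.length := by simpa using hlen
      have : seenChk (g :: m) (segChk N S) = some .last := by
        rw [seenChk, h₁, hm]
        simp
      rw [this]
      simp [fpMove]

end FreeProduct

end CSPDA

/-! ### The language of the machine, and condition (3) for it. -/

theorem Reduces.append_left {B K Γ : Type*} [Group Γ] {lab : B → K} {val : B → Γ} {w x : List B}
    (h : Reduces lab val w x) (u : List B) : Reduces lab val (u ++ w) (u ++ x) := by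
  induction u with
  | nil => exact h
  | cons b u ih => exact ih.cons b

theorem List.exists_forall₂ {α β : Type*} {Q : β → Prop} {R : α → β → Prop} {l : List α}
    (h : ∀ a ∈ l, ∃ b, Q b ∧ R a b) : ∃ l', (∀ b ∈ l', Q b) ∧ List.Forall₂ R l l' := by
  induction l with
  | nil => exact ⟨[], by simp, .nil⟩
  | cons a l ih =>
    obtain ⟨b, hb, hab⟩ := h a (by simp)
    obtain ⟨l', h₁, h₂⟩ := ih fun a ha => h a (by simp [ha])
    exact ⟨b :: l', List.forall_mem_cons.2 ⟨hb, h₁⟩, .cons hab h₂⟩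

namespace CSPDA

section FreeProduct

universe u v

variable {K : Type} {A : K → Type u} {N : ∀ k, CSPDA (A k)} {B₀ : Type}
  {B : Type v} {lab : B₀ → K} {dec : ∀ k, B₀ → Option (A k)} {code : B → B₀}
  [DecidableEq K] [Finite K] [Finite B₀]
  (hdec : ∀ k b, (dec k b).isSome ↔ lab b = k) (hN : ∀ k, (N k).IsSpecial)

include hdec hN

theorem run_wordAct (hnil : ∀ k, [] ∉ (N k).language) {S : List (Σ k, (N k).Config)}
    (hS : ∀ y ∈ S, (N y.1).IsEntry y.2) {fs : List (Frame (Σ k, (N k).Config))}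
    (h : ValidFrames Sigma.fst (fun b => lab (code b)) (segAct N dec code) S fs) (w : List B) :
    (∀ fs', wordAct (frameAct Sigma.fst (fun b => lab (code b)) (segAct N dec code) S) fs w =
        some fs' → (freeProduct N lab dec code).RunIn (freeProduct N lab dec code).Within
          (encode lab dec code S fs) w (encode lab dec code S fs')) ∧
    (wordAct (frameAct Sigma.fst (fun b => lab (code b)) (segAct N dec code) S) fs w = none →
      ∃ p c', p <+: w ∧ (freeProduct N lab dec code).RunIn (freeProduct N lab dec code).Within
        (encode lab dec code S fs) p c' ∧ c'.state = (freeProduct N lab dec code).fail) := by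
  induction w generalizing fs with
  | nil =>
    refine ⟨?_, by simp⟩
    rintro fs' hfs
    cases hfs
    refine .refl (within_cfg _ ?_)
    obtain ⟨pre, mid, h₁, -, h₃, -⟩ := layout_of_validFrames hdec hN hS h
    refine h₃.trans ?_
    have := congrArg List.length h₁
    rw [List.length_append] at this
    lia
  | cons b w ih =>
    obtain ⟨h₁, h₂⟩ := run_frameAct (lab := lab) (code := code) hdec hN hS hnil h b
    rw [wordAct_cons]
    cases hb : frameAct Sigma.fst (fun b => lab (code b)) (segAct N dec code) S fs b with
    | none =>
      refine ⟨by simp, fun _ => ?_⟩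
      obtain ⟨c', hc', hf⟩ := h₂ hb
      exact ⟨[b], c', by simp, hc', hf⟩
    | some fs₁ =>
      obtain ⟨h₃, h₄⟩ := ih (h.next hb)
      refine ⟨fun fs' hfs => (h₁ _ hb).trans (h₃ fs' hfs), fun hnone => ?_⟩
      obtain ⟨p, c', hp, hc', hf⟩ := h₄ hnone
      exact ⟨b :: p, c', List.cons_prefix_cons.2 ⟨rfl, hp⟩, (h₁ _ hb).trans hc', hf⟩

variable {H : K → Type*} {Γ : Type*} [∀ k, Group (H k)] [Group Γ] {ψ : ∀ k, H k →* Γ}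
  {val₀ : ∀ k, A k → H k} {val : B → Γ}
  (hψ : ∀ k, Function.Injective (ψ k))
  (hval : ∀ k b a, dec k (code b) = some a → ψ k (val₀ k a) = val b)
  (hL : ∀ k w, w ∈ (N k).language ↔ (w.map (val₀ k)).prod ≠ 1)

omit [DecidableEq K] [Finite K] [Finite B₀] hN in
include hval in
theorem map_prod_filterMap {k : K} {w : List B} (hw : ∀ b ∈ w, lab (code b) = k) :
    ψ k (((w.filterMap fun b => dec k (code b)).map (val₀ k)).prod) = (w.map val).prod := by
  induction w with
  | nil => simp
  | cons b w ih =>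
    obtain ⟨hb, hw⟩ := List.forall_mem_cons.1 hw
    obtain ⟨a, ha⟩ := Option.isSome_iff_exists.1 ((hdec k _).2 hb)
    rw [List.filterMap_cons_some (f := fun b => dec k (code b)) ha]
    simp [ih hw, hval k b a ha]

include hψ hval hL

omit [DecidableEq K] [Finite K] [Finite B₀] in
-- Injectivity of `ψ k` makes a word with trivial value in `Γ` trivial in its factor, where (3)
-- applies.
theorem wordAct_segAct_append {y : Σ k, (N k).Config} (hy : (N y.1).IsEntry y.2) {u v : List B}
    (hu : ∀ b ∈ u, lab (code b) = y.1) (hv : ∀ b ∈ v, lab (code b) = y.1)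
    (hv1 : (v.map val).prod = 1) :
    wordAct (segAct N dec code) y (u ++ v) = none ∨
      wordAct (segAct N dec code) y (u ++ v) = wordAct (segAct N dec code) y u := by
  obtain ⟨k, e⟩ := y
  have huv : ∀ b ∈ u ++ v, lab (code b) = k := fun b hb => (List.mem_append.1 hb).elim (hu b) (hv b)
  rw [wordAct_segAct hdec e huv, wordAct_segAct hdec e hu, List.filterMap_append]
  have h1 : ((v.filterMap fun b => dec k (code b)).map (val₀ k)).prod = 1 :=
    hψ k (by rw [map_prod_filterMap hdec hval hv, hv1, map_one])
  refine ((hN k).wordAct_append_of_prod_eq_one (hL k) hy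
    (u.filterMap fun b => dec k (code b)) h1).imp ?_ ?_
  · intro h; rw [h]; rfl
  · intro h; rw [h]

omit [DecidableEq K] [Finite K] [Finite B₀] hψ in
-- Over a finite alphabet there are finitely many words of length at most `n`;
-- `exists_entry_wordAct_ne` is applied with all of them as words that must not fail.
theorem exists_seg [∀ k, Finite (A k)] (hinv : ∀ k a, ∃ a', val₀ k a' = (val₀ k a)⁻¹) (n : ℕ)
    {k : K} {x : List B} (hx : ∀ b ∈ x, lab (code b) = k) (hx1 : (x.map val).prod ≠ 1) :
    ∃ y : Σ k, (N k).Config, ((N y.1).IsEntry y.2 ∧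
      Lasts Sigma.fst (fun b => lab (code b)) (segAct N dec code) n y) ∧
      y.1 = k ∧ wordAct (segAct N dec code) y x ≠ some y := by
  have h1 : ((x.filterMap fun b => dec k (code b)).map (val₀ k)).prod ≠ 1 := by
    intro h
    rw [← map_prod_filterMap (ψ := ψ) hdec hval hx, h, map_one] at hx1
    exact hx1 rfl
  have hfin := List.finite_length_le (A k) n
  obtain ⟨e, he, h₂, h₃⟩ := (hN k).exists_entry_wordAct_ne (hL k) (hinv k) h1 hfin.toFinset.toList
  refine ⟨⟨k, e⟩, ⟨he, fun u hu hun => ?_⟩, rfl, ?_⟩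
  · rw [wordAct_segAct hdec e hu]
    have := h₂ (u.filterMap fun b => dec k (code b))
      (by simpa using (List.length_filterMap_le _ _).trans hun)
    simpa using this
  · rw [wordAct_segAct hdec e hx]
    intro h
    obtain ⟨e', he', h⟩ := Option.map_eq_some_iff.1 h
    cases h
    exact h₃ he'

omit [DecidableEq K] [Finite K] [Finite B₀] hdec hN hψ hval in
theorem nil_notMem_language (k : K) : [] ∉ (N k).language := by
  simp [hL]

variable (hval1 : ∀ b, val b ≠ 1)
  (halt : ∀ xs : List (K × List B), IsAlternating (fun b => lab (code b)) val xs → xs ≠ [] →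
    ((xs.flatMap Prod.snd).map val).prod ≠ 1)

include hval1 halt

omit [DecidableEq K] [Finite K] [Finite B₀] hdec hN hψ hval hL in
-- The alternating word obtained by reduction has the same value as `w`, so `halt` forces it to be
-- empty.
theorem reduces_nil {w : List B} (hw : (w.map val).prod = 1) :
    Reduces (fun b => lab (code b)) val w [] := by
  obtain ⟨xs, hxs, h⟩ := exists_reduces (lab := fun b => lab (code b)) hval1 w
  have : xs = [] := by
    by_contra hne
    exact halt xs hxs hne (h.prod_eq ▸ hw)
  subst this
  exact h

theorem mem_language_freeProduct [Finite B] [∀ k, Finite (A k)]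
    (hinv : ∀ k a, ∃ a', val₀ k a' = (val₀ k a)⁻¹) (w : List B) :
    w ∈ (freeProduct N lab dec code).language ↔ (w.map val).prod ≠ 1 := by
  have hnil := fun k => nil_notMem_language hL k
  constructor
  · rintro ⟨c, c', hc, hrun, p, hacc⟩ hw
    obtain ⟨S, hS, rfl⟩ := (isEntry_iff lab dec code).1 hc
    have hafter : (freeProduct N lab dec code).After (encode lab dec code S []) w c' :=
      ⟨hrun, _, hacc⟩
    obtain ⟨h₁, h₂⟩ := run_wordAct (lab := lab) (code := code) hdec hN hnil hS .nil w
    -- Either `w` fails, contradicting the accepting run, or it returns to the empty stack of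
    -- syllables, whose state is not accepting.
    obtain h | h := (reduces_nil hval1 halt hw).wordAct_frameAct (lbl := Sigma.fst)
      (act := segAct N dec code) (S := S) fun y hy u v hu hv hv1 =>
        wordAct_segAct_append hdec hN hψ hval hL (hS y hy) hu hv hv1
    · obtain ⟨p, c', hp, hr, hf⟩ := h₂ h
      exact (freeProduct_deterministic N lab dec code).not_fails hafter ⟨p, c', hp, hr.run, hf⟩
    · have hr := h₁ [] h
      have := (freeProduct_deterministic N lab dec code).after_unique hafter
        ⟨hr.run, none, rfl⟩
      rw [this] at hacc
      cases hacc
  · intro hw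
    obtain ⟨xs, hxs, hred⟩ := exists_reduces (lab := fun b => lab (code b)) hval1 w
    obtain ⟨ys, hys, hxy⟩ := List.exists_forall₂ (l := xs)
      (Q := fun y : Σ k, (N k).Config => (N y.1).IsEntry y.2 ∧
        Lasts Sigma.fst (fun b => lab (code b)) (segAct N dec code) w.length y)
      (R := fun p y => y.1 = p.1 ∧ wordAct (segAct N dec code) y p.2 ≠ some y)
      fun p hp => exists_seg hdec hN hval hL hinv w.length (hxs.lab_eq p hp) (hxs.prod_ne p hp)
    -- One surviving segment for each letter's label; that it is moved by `[b]` plays no role here.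
    have hblock : ∀ b : B, ∃ y : Σ k, (N k).Config, ((N y.1).IsEntry y.2 ∧
        Lasts Sigma.fst (fun b => lab (code b)) (segAct N dec code) w.length y) ∧
        y.1 = lab (code b) := by
      intro b
      obtain ⟨y, h₁, h₂, -⟩ := exists_seg hdec hN hval hL hinv w.length (x := [b])
        (k := lab (code b)) (by simp) (by simpa using hval1 b)
      exact ⟨y, h₁, h₂⟩
    choose seg hseg hseg' using hblock
    have := Fintype.ofFinite B
    set l := (Finset.univ : Finset B).toList.map seg with hl
    -- The segments `ys` detect the reduced word; the blocks ensure that `w` itself, which may open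
    -- other syllables, never runs out of segments.
    set S := ys ++ (List.replicate w.length l).flatten with hSdef
    have hS : ∀ y ∈ S, (N y.1).IsEntry y.2 ∧
        Lasts Sigma.fst (fun b => lab (code b)) (segAct N dec code) w.length y := by
      intro y hy
      obtain hy | hy := List.mem_append.1 hy
      · exact hys y hy
      · obtain ⟨l', hl', hy⟩ := List.mem_flatten.1 hy
        rw [(List.mem_replicate.1 hl').2, hl] at hy
        obtain ⟨b, -, rfl⟩ := List.mem_map.1 hy
        exact hseg b
    have hrich : Rich Sigma.fst (fun b => lab (code b)) w.length S := by
      refine (Rich.flatten_replicate (fun b => ?_) _).append _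
      exact ⟨seg b, by simp [hl], hseg' b⟩
    have hne := Safe.wordAct_ne_none (n := 0) (w := w) (fs := []) (fun y hy => (hS y hy).2) .nil
      ⟨hrich, by simp⟩ (by simp)
    obtain ⟨fs, hfs⟩ := Option.ne_none_iff_exists'.1 hne
    -- As `w` does not fail, it has the same effect as the reduced word, whose syllables all remain
    -- on the stack.
    have hred' := (hred.wordAct_frameAct (lbl := Sigma.fst)
      (act := segAct N dec code) (S := S) fun y hy u v hu hv hv1 =>
        wordAct_segAct_append hdec hN hψ hval hL (hS y hy).1 hu hv hv1).resolve_left hne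
    have hlen := length_wordAct_flatMap hxs hxy (S := S) (fs := []) (fs' := fs) rfl (by simp)
      (hred'.symm.trans hfs)
    have hrun := (run_wordAct (lab := lab) (code := code) hdec hN hnil
      (fun y hy => (hS y hy).1) .nil w).1 fs hfs
    refine ⟨_, _, (isEntry_iff lab dec code).2 ⟨S, fun y hy => (hS y hy).1, rfl⟩, hrun.run, ?_⟩
    cases fs with
    | nil =>
      have hxs0 : xs = [] := by simpa using hlen.symm
      subst hxs0
      exact absurd hred.prod_eq (by simpa using hw)
    | cons f fs => exact ⟨_, rfl⟩

theorem isSpecial_freeProduct [Finite B] [∀ k, Finite (A k)]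
    (hinv : ∀ k a, ∃ a', val₀ k a' = (val₀ k a)⁻¹) :
    (freeProduct N lab dec code).IsSpecial := by
  have hnil := fun k => nil_notMem_language hL k
  refine (freeProduct_deterministic N lab dec code).isSpecial ?_ ?_ ?_
  · intro c hc w
    obtain ⟨S, hS, rfl⟩ := (isEntry_iff lab dec code).1 hc
    obtain ⟨h₁, h₂⟩ := run_wordAct (lab := lab) (code := code) hdec hN hnil hS .nil w
    cases h : wordAct (frameAct Sigma.fst (fun b => lab (code b)) (segAct N dec code) S) [] w with
    | none => exact .inr (h₂ h)
    | some fs => exact .inl ⟨_, h₁ fs h, _, rfl⟩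
  · intro c hc
    obtain ⟨S, hS, rfl⟩ := (isEntry_iff lab dec code).1 hc
    exact ⟨_, rfl⟩
  · intro c hc u v hv
    obtain ⟨S, hS, rfl⟩ := (isEntry_iff lab dec code).1 hc
    rw [mem_language_freeProduct hdec hN hψ hval hL hval1 halt hinv, not_not] at hv
    -- Since `v` reduces to the empty word, `u ++ v` reduces to `u`; so the two lead to the same
    -- stack, or `u ++ v` fails.
    have hred := (reduces_nil hval1 halt hv).append_left u
    rw [List.append_nil] at hred
    obtain ⟨h₁, h₂⟩ := run_wordAct (lab := lab) (code := code) hdec hN hnil hS .nil (u ++ v)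
    obtain ⟨h₃, -⟩ := run_wordAct (lab := lab) (code := code) hdec hN hnil hS .nil u
    cases h : wordAct (frameAct Sigma.fst (fun b => lab (code b)) (segAct N dec code) S)
        [] (u ++ v) with
    | none =>
      obtain ⟨p, c', hp, hr, hf⟩ := h₂ h
      exact .inr ⟨p, c', hp, hr.run, hf⟩
    | some fs =>
      have h' := (hred.wordAct_frameAct (lbl := Sigma.fst)
        (act := segAct N dec code) (S := S) fun y hy u v hu hv hv1 =>
          wordAct_segAct_append hdec hN hψ hval hL (hS y hy) hu hv hv1).resolve_left (by simp [h])
      exact .inl ⟨_, ⟨(h₁ fs h).run, _, rfl⟩, (h₃ fs (h'.symm.trans h)).run, _, rfl⟩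

end FreeProduct

end CSPDA

/-! ### Normal forms in the free product, and the main theorem. -/

section CoprodI

open Monoid

variable {ι : Type*} {G : ι → Type*} [∀ i, Group (G i)]

/-- Alternating products of nontrivial elements of the factors are nontrivial. -/
theorem Monoid.CoprodI.prod_ne_one_of_isChain {l : List (Σ i, G i)} (h1 : ∀ x ∈ l, x.2 ≠ 1)
    (hl : (l.map Sigma.fst).IsChain (· ≠ ·)) (hne : l ≠ []) :
    (l.map fun x => CoprodI.of x.2).prod ≠ 1 := by
  classical
  intro h
  rw [List.isChain_map] at hl
  have h' : CoprodI.Word.equiv.symm (⟨l, h1, hl⟩ : CoprodI.Word G) =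
      CoprodI.Word.equiv.symm CoprodI.Word.empty := by
    change CoprodI.Word.prod _ = CoprodI.Word.prod _
    rw [CoprodI.Word.prod_empty]
    exact h
  exact hne (congrArg CoprodI.Word.toList (CoprodI.Word.equiv.symm.injective h'))

/-- Each syllable is multiplied out inside its own factor, so that the normal form theorem can be
applied to the resulting list. -/
theorem exists_factors_of_isAlternating {B K : Type*} {lab : B → K} {e : K ≃ ι}
    {val : B → CoprodI G} (hval : ∀ b, ∃ g : G (e (lab b)), CoprodI.of g = val b)
    {xs : List (K × List B)} (hxs : IsAlternating lab val xs) :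
    ∃ l : List (Σ i, G i), (∀ x ∈ l, x.2 ≠ 1) ∧ l.map Sigma.fst = xs.map (fun p => e p.1) ∧
      (l.map fun x => CoprodI.of x.2).prod = ((xs.flatMap Prod.snd).map val).prod := by
  induction xs with
  | nil => exact ⟨[], by simp⟩
  | cons p xs ih =>
    obtain ⟨l, h₁, h₂, h₃⟩ := ih hxs.tail
    have key : ∀ x : List B, (∀ b ∈ x, lab b = p.1) →
        ∃ g : G (e p.1), CoprodI.of g = (x.map val).prod := by
      intro x hx
      induction x with
      | nil => exact ⟨1, by simp⟩
      | cons b x ih =>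
        obtain ⟨hb, hx⟩ := List.forall_mem_cons.1 hx
        obtain ⟨g, hg⟩ := ih hx
        have hvb := hval b
        rw [hb] at hvb
        obtain ⟨g', hg'⟩ := hvb
        exact ⟨g' * g, by simp [hg, hg']⟩
    obtain ⟨g, hg⟩ := key p.2 (hxs.lab_eq p (by simp))
    refine ⟨⟨e p.1, g⟩ :: l, List.forall_mem_cons.2 ⟨?_, h₁⟩, by simp [h₂], by simp [h₃, hg]⟩
    rintro h1
    simp only at h1
    rw [h1, map_one] at hg
    exact hxs.prod_ne p (by simp) hg.symm

end CoprodI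

theorem mainTheorem6 {ι : Type*} [Finite ι] (G : ι → Type*) [∀ i, Group (G i)]
    (hG : ∀ i, IsSpecialCoET0L (G i)) : IsSpecialCoET0L (Monoid.CoprodI G) := by
  classical
  choose A hAinv hAgen N hN hNL using hG
  -- Indices and letters occur in states and stack symbols, which must live in `Type`; both are
  -- therefore replaced by elements of some `Fin`.
  obtain ⟨n, ⟨e'⟩⟩ := Finite.exists_equiv_fin ι
  set e := e'.symm
  let f : (Σ k : Fin n, A (e k)) → Monoid.CoprodI G := fun t => Monoid.CoprodI.of (t.2 : G (e t.1))
  -- Generators equal to `1` are dropped, so that every single letter is a nontrivial syllable; the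
  -- rest still generates.
  have hfin : (Set.range f \ {1}).Finite := (Set.finite_range f).sdiff
  let gens : Finset (Monoid.CoprodI G) := hfin.toFinset
  have hmem : ∀ x, x ∈ gens ↔ (∃ t, f t = x) ∧ x ≠ 1 := fun x => by simp [gens]
  have hdecode : ∀ b : gens, ∃ t, f t = b := fun b => ((hmem b).1 b.2).1
  choose t ht using hdecode
  obtain ⟨m, ⟨code⟩⟩ := Finite.exists_equiv_fin gens
  let lab : Fin m → Fin n := fun b => (t (code.symm b)).1
  let dec : ∀ k : Fin n, Fin m → Option (A (e k)) := fun k b =>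
    if h : (t (code.symm b)).1 = k then some (h ▸ (t (code.symm b)).2) else none
  have hdec : ∀ k b, (dec k b).isSome ↔ lab b = k := by
    intro k b
    simp only [dec, lab]
    split_ifs with h <;> simp [h]
  have hdec' : ∀ k b a, dec k (code b) = some a → f ⟨k, a⟩ = b := by
    intro k b a h
    have key : ∀ b' a, dec k b' = some a → f ⟨k, a⟩ = code.symm b' := by
      intro b' a h
      simp only [dec] at h
      split_ifs at h with hk
      subst hk
      cases h
      exact ht _
    simpa using key _ a h
  have hval1 : ∀ b : gens, (b : Monoid.CoprodI G) ≠ 1 := fun b => ((hmem b).1 b.2).2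
  have hinv : ∀ (k : Fin n) (a : A (e k)), ∃ a' : A (e k), (a' : G (e k)) = (a : G (e k))⁻¹ :=
    fun k a => ⟨⟨_, hAinv _ _ a.2⟩, rfl⟩
  have hL : ∀ (k : Fin n) (w : List (A (e k))), w ∈ (N (e k)).language ↔
      (w.map fun a : A (e k) => (a : G (e k))).prod ≠ 1 := by
    intro k w
    rw [hNL]
    rfl
  have halt : ∀ xs : List (Fin n × List gens),
      IsAlternating (fun b => lab (code b)) (fun b : gens => (b : Monoid.CoprodI G)) xs →
      xs ≠ [] → ((xs.flatMap Prod.snd).map fun b : gens => (b : Monoid.CoprodI G)).prod ≠ 1 := by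
    intro xs hxs hne
    obtain ⟨l, h₁, h₂, h₃⟩ := exists_factors_of_isAlternating (e := e) (fun b =>
      ⟨((t (code.symm (code b))).2 : G _), (ht (code.symm (code b))).trans
        (congrArg Subtype.val (code.symm_apply_apply b))⟩) hxs
    rw [← h₃]
    refine Monoid.CoprodI.prod_ne_one_of_isChain h₁ ?_ ?_
    · rw [h₂, List.isChain_map]
      exact hxs.chain.imp fun p q hpq => e.injective.ne hpq
    · rintro rfl
      exact hne (by simpa using h₂.symm)
  have hψ : ∀ k : Fin n, Function.Injective (Monoid.CoprodI.of (i := e k) (M := G)) :=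
    fun k => Monoid.CoprodI.of_injective _
  refine ⟨gens, ?_, ?_, CSPDA.freeProduct (fun k => N (e k)) lab dec code, ?_, ?_⟩
  · intro x hx
    obtain ⟨⟨⟨k, a⟩, rfl⟩, h1⟩ := (hmem x).1 hx
    exact (hmem _).2 ⟨⟨⟨k, ⟨_, hAinv _ _ a.2⟩⟩, map_inv _ _⟩, inv_ne_one.2 h1⟩
  · rw [eq_top_iff]
    rintro x -
    induction x using Monoid.CoprodI.induction_on with
    | one => exact one_mem _
    | mul x y hx hy => exact mul_mem hx hy
    | of i g =>
      obtain ⟨k, rfl⟩ := e.surjective i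
      have : Subgroup.closure (A (e k) : Set (G (e k))) ≤
          (Subgroup.closure (gens : Set (Monoid.CoprodI G))).comap Monoid.CoprodI.of := by
        rw [Subgroup.closure_le]
        intro a ha
        by_cases h1 : f ⟨k, ⟨a, ha⟩⟩ = 1
        · exact (congrArg (· ∈ Subgroup.closure (gens : Set (Monoid.CoprodI G))) h1).mpr
            (one_mem _)
        · exact Subgroup.subset_closure ((hmem _).2 ⟨⟨⟨k, ⟨a, ha⟩⟩, rfl⟩, h1⟩)
      exact this (hAgen (e k) ▸ Subgroup.mem_top g)
  · exact CSPDA.isSpecial_freeProduct hdec (fun k => hN (e k)) hψ hdec' hL hval1 halt hinv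
  · ext w
    exact CSPDA.mem_language_freeProduct hdec (fun k => hN (e k)) hψ hdec' hL hval1 halt hinv w
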